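/- Let $F$ be Thompson's group: the group, under composition $(fg)(x)=f(g(x))$, of all orientation-preserving piecewise linear homeomorphisms of $[0,1]$ with finitely many breakpoints, all at dyadic rationals, and with all slopes powers of $2$. Let $x_0\in F$ be the map that sends $0,\frac12,\frac34,1$ to $0,\frac14,\frac12,1$ and is affine in between, and let $x_1\in F$ be the identity on $[0,\frac12]$ and $x_1(x)=\frac12\bigl(1+x_0(2x-1)\bigr)$ on $[\frac12,1]$. The support of $f\in F$ is the closure of $\{x : f(x)\neq x\}$. For $l\ge 1$ let $\mathcal G_l$ be the space of marked groups $(G,S)$, i.e. groups $G$ with an ordered generating $l$-tuple $S$, up to isomorphisms matching the tuples, with the metric in which two marked groups are at distance at most $e^{-R}$ ($R\in\mathbb N$) if and only if they have the same relations of length at most $R$. A finitely generated group $G$ is fully residually Thompson if for every finite set of nontrivial elements of $G$ there is a surjective homomorphism from $G$ onto a group isomorphic to $F$ under which all their images are nontrivial. Let $l\ge 3$. For $m\in\mathbb N$ and $\varepsilon>0$ with $2^{m^2}\varepsilon<\frac12$, call $(u_1,\dots,u_{l-2})\in F^{l-2}$ *admissible* for $(m,\varepsilon)$ if every $u_i$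 has support in $[0,\varepsilon)$ and if, for every nontrivial reduced word $w(a,b_1,\dots,b_{l-2})$ of length at most $2m^2$ in the free group of rank $l-1$, the element $w(x_0,u_1,\dots,u_{l-2})$ moves some point of $[0,\varepsilon)$. Then: 1. For all $m\in\mathbb N$ and $\varepsilon>0$ with $2^{m^2}\varepsilon<\frac12$, an admissible tuple for $(m,\varepsilon)$ exists. 2. For all $\varepsilon_m>0$ with $2^{m^2}\varepsilon_m<\frac12$ and all tuples $(u_{1,m},\dots,u_{l-2,m})$ admissible for $(m,\varepsilon_m)$, $m\in\mathbb N$, the tuple $(x_0,\ x_0^m u_{1,m}^m x_1,\ u_{1,m},\dots,u_{l-2,m})$ generates $F$ for every $m$, and the marked groups $$\bigl(F,\ (x_0,\ x_0^m u_{1,m}^m x_1,\ u_{1,m},\dots,u_{l-2,m})\bigr)$$ converge in $\mathcal G_l$, as $m\to\infty$, to the free group $F_l$ of rank $l$ marked by its standard basis. 3. The free group $F_l$ is fully residually Thompson. -/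

import Mathlib

open Filter Topology

/-! ## Thompson's group `F` -/

/-- A dyadic rational number, as a real number. -/
def IsDyadic (x : ℝ) : Prop := ∃ (a : ℤ) (n : ℕ), x = (a : ℝ) / 2 ^ n

theorem IsDyadic.add {x y : ℝ} (hx : IsDyadic x) (hy : IsDyadic y) : IsDyadic (x + y) := by
  obtain ⟨a, n, rfl⟩ := hx
  obtain ⟨b, m, rfl⟩ := hy
  refine ⟨a * 2 ^ m + b * 2 ^ n, n + m, ?_⟩
  push_cast
  field_simp
  ring

theorem IsDyadic.neg {x : ℝ} (hx : IsDyadic x) : IsDyadic (-x) := by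
  obtain ⟨a, n, rfl⟩ := hx
  exact ⟨-a, n, by push_cast; ring⟩

theorem IsDyadic.mul {x y : ℝ} (hx : IsDyadic x) (hy : IsDyadic y) : IsDyadic (x * y) := by
  obtain ⟨a, n, rfl⟩ := hx
  obtain ⟨b, m, rfl⟩ := hy
  refine ⟨a * b, n + m, ?_⟩
  push_cast
  rw [pow_add, div_mul_div_comm]

theorem IsDyadic.two_zpow (k : ℤ) : IsDyadic ((2 : ℝ) ^ k) := by
  rcases Int.eq_nat_or_neg k with ⟨n, rfl | rfl⟩
  · exact ⟨2 ^ n, 0, by simp⟩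
  · exact ⟨1, n, by simp⟩

/-- `f` is piecewise linear on `[0,1]` with finitely many breakpoints, all of them dyadic (and
contained in `B`), and all its slopes are powers of `2`: on every interval `[a, b]` with no point of
`B` in its interior, `f` is affine with slope `2 ^ k` for some integer `k`. -/
def IsDyadicPL (f : unitInterval ≃ₜ unitInterval) : Prop :=
  ∃ B : Finset unitInterval, (∀ b ∈ B, IsDyadic (b : ℝ)) ∧
    ∀ a b : unitInterval, a < b → (∀ c ∈ B, ¬ (a < c ∧ c < b)) →
      ∃ k : ℤ, ∀ x : unitInterval, a ≤ x → x ≤ b →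
        (f x : ℝ) = (f a : ℝ) + 2 ^ k * ((x : ℝ) - (a : ℝ))

theorem strictMono_map_zero {f : unitInterval ≃ₜ unitInterval} (hf : StrictMono f) : f 0 = 0 := by
  apply le_antisymm _ unitInterval.nonneg'
  have h : f 0 ≤ f (f.symm 0) := hf.monotone unitInterval.nonneg'
  simpa using h

theorem IsDyadicPL.map_dyadic {f : unitInterval ≃ₜ unitInterval} (hf : StrictMono f)
    (h : IsDyadicPL f) (d : unitInterval) (hd : IsDyadic (d : ℝ)) : IsDyadic (f d : ℝ) := by
  classical
  obtain ⟨B, hB, hlin⟩ := h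
  have key : ∀ n : ℕ, ∀ d : unitInterval, IsDyadic (d : ℝ) → (B.filter (· < d)).card = n →
      IsDyadic (f d : ℝ) := by
    intro n
    induction n using Nat.strong_induction_on with
    | _ n ih =>
      intro d hd hn
      have step : ∀ a : unitInterval, a < d → (∀ c ∈ B, ¬ (a < c ∧ c < d)) →
          IsDyadic (a : ℝ) → IsDyadic (f a : ℝ) → IsDyadic (f d : ℝ) := by
        intro a had hc ha hfa
        obtain ⟨k, hk⟩ := hlin a d had hc
        rw [hk d had.le le_rfl, sub_eq_add_neg]
        exact hfa.add ((IsDyadic.two_zpow k).mul (hd.add ha.neg))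
      rcases (B.filter (· < d)).eq_empty_or_nonempty with he | hne
      · rcases eq_or_lt_of_le (unitInterval.nonneg' : 0 ≤ d) with h0 | h0
        · rw [← h0, strictMono_map_zero hf]
          exact ⟨0, 0, by simp⟩
        · refine step 0 h0 ?_ ⟨0, 0, by simp⟩ (by
            rw [strictMono_map_zero hf]; exact ⟨0, 0, by simp⟩)
          rintro c hc ⟨_, hcd⟩
          have : c ∈ B.filter (· < d) := by simp [hc, hcd]
          simp [he] at this
      · obtain ⟨b, hb, hmax⟩ := (B.filter (· < d)).exists_max_image id hne
        simp only [Finset.mem_filter] at hb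
        refine step b hb.2 ?_ (hB b hb.1) ?_
        · rintro c hc ⟨hbc, hcd⟩
          exact absurd (hmax c (by simp [hc, hcd])) (not_le.2 hbc)
        · refine ih _ ?_ b (hB b hb.1) rfl
          rw [← hn]
          apply Finset.card_lt_card
          refine ⟨fun c hc => ?_, fun hsub => ?_⟩
          · simp only [Finset.mem_filter] at hc ⊢
            exact ⟨hc.1, hc.2.trans hb.2⟩
          · have := hsub (Finset.mem_filter.2 hb)
            simp at this
  exact key _ d hd rfl

theorem strictMono_homeo_inv {f : unitInterval ≃ₜ unitInterval} (hf : StrictMono f) :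
    StrictMono (f⁻¹ : unitInterval ≃ₜ unitInterval) := by
  intro x y hxy
  have h : f (f.symm x) < f (f.symm y) := by simpa using hxy
  exact hf.lt_iff_lt.1 h

theorem IsDyadicPL.inv {f : unitInterval ≃ₜ unitInterval} (hf : StrictMono f)
    (h : IsDyadicPL f) : IsDyadicPL f⁻¹ := by
  classical
  have hd := fun d hd => h.map_dyadic hf d hd
  obtain ⟨B, hB, hlin⟩ := h
  have hmono := strictMono_homeo_inv hf
  have hfi : ∀ x, f (f⁻¹ x) = x := fun x => f.apply_symm_apply x
  have hif : ∀ x, f⁻¹ (f x) = x := fun x => f.symm_apply_apply x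
  refine ⟨B.image f, ?_, ?_⟩
  · intro b hb
    obtain ⟨c, hc, rfl⟩ := Finset.mem_image.1 hb
    exact hd c (hB c hc)
  · intro a b hab hc
    obtain ⟨k, hk⟩ := hlin (f⁻¹ a) (f⁻¹ b) (hmono hab) (by
      rintro c hcB ⟨h1, h2⟩
      refine hc (f c) (Finset.mem_image_of_mem _ hcB) ⟨?_, ?_⟩
      · simpa [hfi] using hf h1
      · simpa [hfi] using hf h2)
    refine ⟨-k, fun x hax hxb => ?_⟩
    have h := hk (f⁻¹ x) (hmono.monotone hax) (hmono.monotone hxb)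
    rw [hfi, hfi] at h
    rw [h, zpow_neg]
    field_simp
    ring

theorem IsDyadicPL.mul {f g : unitInterval ≃ₜ unitInterval} (hg : StrictMono g)
    (h : IsDyadicPL f) (h' : IsDyadicPL g) : IsDyadicPL (f * g) := by
  classical
  have hd := fun d hd => (h'.inv hg).map_dyadic (strictMono_homeo_inv hg) d hd
  obtain ⟨B, hB, hlin⟩ := h
  obtain ⟨C, hC, hlin'⟩ := h'
  have hif : ∀ x, g⁻¹ (g x) = x := fun x => g.symm_apply_apply x
  have hfi : ∀ x, g (g⁻¹ x) = x := fun x => g.apply_symm_apply x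
  refine ⟨C ∪ B.image (g⁻¹ : unitInterval ≃ₜ unitInterval), ?_, ?_⟩
  · intro b hb
    rcases Finset.mem_union.1 hb with hb | hb
    · exact hC b hb
    · obtain ⟨c, hc, rfl⟩ := Finset.mem_image.1 hb
      exact hd c (hB c hc)
  · intro a b hab hc
    obtain ⟨k, hk⟩ := hlin' a b hab (fun c hcC => hc c (Finset.mem_union_left _ hcC))
    obtain ⟨j, hj⟩ := hlin (g a) (g b) (hg hab) (by
      rintro c hcB ⟨h1, h2⟩
      refine hc (g⁻¹ c) (Finset.mem_union_right _ (Finset.mem_image_of_mem _ hcB)) ⟨?_, ?_⟩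
      · simpa [hif] using strictMono_homeo_inv hg h1
      · simpa [hif] using strictMono_homeo_inv hg h2)
    refine ⟨j + k, fun x hax hxb => ?_⟩
    have h1 := hk x hax hxb
    have h2 := hj (g x) (hg.monotone hax) (hg.monotone hxb)
    change (f (g x) : ℝ) = (f (g a) : ℝ) + _
    rw [h2, h1, zpow_add₀ (by norm_num)]
    ring

/-- Thompson's group `F`: the orientation-preserving (i.e. increasing) piecewise linear
homeomorphisms of `[0,1]` with finitely many breakpoints, all dyadic, and with slopes powers of `2`.
The product is composition, `(f * g) x = f (g x)`. -/
def ThompsonF : Subgroup (unitInterval ≃ₜ unitInterval) where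
  carrier := {f | StrictMono f ∧ IsDyadicPL f}
  mul_mem' := fun ha hb => ⟨ha.1.comp hb.1, ha.2.mul hb.1 hb.2⟩
  one_mem' := ⟨fun _ _ h => h, ∅, by simp, fun a b _ _ => ⟨0, fun x _ _ => by simp⟩⟩
  inv_mem' := fun ha => ⟨strictMono_homeo_inv ha.1, ha.2.inv ha.1⟩

/-- An element of `F` as a self-map of `[0,1]`. -/
instance : CoeFun ThompsonF (fun _ => unitInterval → unitInterval) := ⟨fun f => f.1⟩

/-- The standard generator `x₀` as a real function: `0, 1/2, 3/4, 1` are mapped to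
`0, 1/4, 1/2, 1`, and it is affine in between. -/
noncomputable def x0Fun (x : ℝ) : ℝ :=
  if x ≤ 1 / 2 then x / 2 else if x ≤ 3 / 4 then x - 1 / 4 else 2 * x - 1

/-- The inverse of `x0Fun`. -/
noncomputable def x0InvFun (x : ℝ) : ℝ :=
  if x ≤ 1 / 4 then 2 * x else if x ≤ 1 / 2 then x + 1 / 4 else (x + 1) / 2

/-- The standard generator `x₁` as a real function: the identity on `[0,1/2]`, and `x₀` rescaled
to `[1/2,1]` on that interval. -/
noncomputable def x1Fun (x : ℝ) : ℝ :=
  if x ≤ 1 / 2 then x else (1 + x0Fun (2 * x - 1)) / 2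

/-- The inverse of `x1Fun`. -/
noncomputable def x1InvFun (x : ℝ) : ℝ :=
  if x ≤ 1 / 2 then x else (1 + x0InvFun (2 * x - 1)) / 2

/-- The homeomorphism of `[0,1]` given by a strictly increasing real function that preserves
`[0,1]` and has a two-sided inverse preserving `[0,1]`. -/
noncomputable def homeoOfFun (f g : ℝ → ℝ) (hf : ∀ x ∈ unitInterval, f x ∈ unitInterval)
    (hg : ∀ x ∈ unitInterval, g x ∈ unitInterval) (hm : StrictMono f)
    (hfg : ∀ x, f (g x) = x) : unitInterval ≃ₜ unitInterval :=
  (StrictMono.orderIsoOfRightInverse (fun x : unitInterval => (⟨f x, hf x x.2⟩ : unitInterval))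
    (fun _ _ h => hm h) (fun x : unitInterval => (⟨g x, hg x x.2⟩ : unitInterval))
    (fun x => Subtype.ext (hfg x))).toHomeomorph

theorem x0Fun_strictMono : StrictMono x0Fun := by
  intro x y h
  unfold x0Fun
  split_ifs <;> linarith

theorem x0Fun_x0InvFun (x : ℝ) : x0Fun (x0InvFun x) = x := by
  unfold x0Fun x0InvFun
  split_ifs <;> linarith

theorem x1Fun_strictMono : StrictMono x1Fun := by
  intro x y h
  unfold x1Fun x0Fun
  split_ifs <;> linarith

theorem x1Fun_x1InvFun (x : ℝ) : x1Fun (x1InvFun x) = x := by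
  unfold x1Fun x1InvFun x0Fun x0InvFun
  split_ifs <;> linarith

noncomputable def x0Homeo : unitInterval ≃ₜ unitInterval :=
  homeoOfFun x0Fun x0InvFun
    (by rintro x ⟨h0, h1⟩; unfold x0Fun; split_ifs <;> constructor <;> linarith)
    (by rintro x ⟨h0, h1⟩; unfold x0InvFun; split_ifs <;> constructor <;> linarith)
    x0Fun_strictMono x0Fun_x0InvFun

noncomputable def x1Homeo : unitInterval ≃ₜ unitInterval :=
  homeoOfFun x1Fun x1InvFun
    (by rintro x ⟨h0, h1⟩; unfold x1Fun x0Fun; split_ifs <;> constructor <;> linarith)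
    (by rintro x ⟨h0, h1⟩; unfold x1InvFun x0InvFun; split_ifs <;> constructor <;> linarith)
    x1Fun_strictMono x1Fun_x1InvFun

theorem x0Homeo_isDyadicPL : IsDyadicPL x0Homeo := by
  refine ⟨{⟨1 / 2, by constructor <;> norm_num⟩, ⟨3 / 4, by constructor <;> norm_num⟩}, ?_, ?_⟩
  · simp only [Finset.mem_insert, Finset.mem_singleton]
    rintro b (rfl | rfl)
    · exact ⟨1, 1, by norm_num⟩
    · exact ⟨3, 2, by norm_num⟩
  · intro a b hab hc
    have h1 := hc ⟨1 / 2, by constructor <;> norm_num⟩ (by simp)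
    have h2 := hc ⟨3 / 4, by constructor <;> norm_num⟩ (by simp)
    have hval : ∀ x : unitInterval, (x0Homeo x : ℝ) = x0Fun x := fun x => rfl
    simp only [hval]
    simp only [← Subtype.coe_lt_coe, ← Subtype.coe_le_coe, not_and, not_lt] at h1 h2 hab ⊢
    unfold x0Fun
    by_cases ha : (a : ℝ) < 1 / 2
    · have := h1 ha
      refine ⟨-1, fun x hax hxb => ?_⟩
      rw [if_pos (by linarith), if_pos (by linarith), zpow_neg_one]
      ring
    by_cases ha' : (a : ℝ) < 3 / 4
    · have := h2 ha'
      refine ⟨0, fun x hax hxb => ?_⟩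
      rw [zpow_zero]
      split_ifs <;> linarith
    · refine ⟨1, fun x hax hxb => ?_⟩
      rw [zpow_one]
      split_ifs <;> linarith

theorem x1Homeo_isDyadicPL : IsDyadicPL x1Homeo := by
  refine ⟨{⟨1 / 2, by constructor <;> norm_num⟩, ⟨3 / 4, by constructor <;> norm_num⟩,
    ⟨7 / 8, by constructor <;> norm_num⟩}, ?_, ?_⟩
  · simp only [Finset.mem_insert, Finset.mem_singleton]
    rintro b (rfl | rfl | rfl)
    · exact ⟨1, 1, by norm_num⟩
    · exact ⟨3, 2, by norm_num⟩
    · exact ⟨7, 3, by norm_num⟩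
  · intro a b hab hc
    have h1 := hc ⟨1 / 2, by constructor <;> norm_num⟩ (by simp)
    have h2 := hc ⟨3 / 4, by constructor <;> norm_num⟩ (by simp)
    have h3 := hc ⟨7 / 8, by constructor <;> norm_num⟩ (by simp)
    have hval : ∀ x : unitInterval, (x1Homeo x : ℝ) = x1Fun x := fun x => rfl
    simp only [hval]
    simp only [← Subtype.coe_lt_coe, ← Subtype.coe_le_coe, not_and, not_lt] at h1 h2 h3 hab ⊢
    unfold x1Fun x0Fun
    by_cases ha : (a : ℝ) < 1 / 2
    · have := h1 ha
      refine ⟨0, fun x hax hxb => ?_⟩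
      rw [if_pos (by linarith), if_pos (by linarith), zpow_zero]
      ring
    by_cases ha' : (a : ℝ) < 3 / 4
    · have := h2 ha'
      refine ⟨-1, fun x hax hxb => ?_⟩
      rw [zpow_neg_one]
      split_ifs <;> linarith
    by_cases ha'' : (a : ℝ) < 7 / 8
    · have := h3 ha''
      refine ⟨0, fun x hax hxb => ?_⟩
      rw [zpow_zero]
      split_ifs <;> linarith
    · refine ⟨1, fun x hax hxb => ?_⟩
      rw [zpow_one]
      split_ifs <;> linarith

/-- The standard generator `x₀` of `F`. -/
noncomputable def x0 : ThompsonF := ⟨x0Homeo, fun _ _ h => x0Fun_strictMono h, x0Homeo_isDyadicPL⟩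

/-- The standard generator `x₁` of `F`. -/
noncomputable def x1 : ThompsonF := ⟨x1Homeo, fun _ _ h => x1Fun_strictMono h, x1Homeo_isDyadicPL⟩

/-! ## The space of marked groups -/

/-- A marked group of length `n`: a group with an ordered generating `n`-tuple. (Such a group is
countable, so up to isomorphism it lives in `Type`.) -/
structure MarkedGroup (n : ℕ) where
  carrier : Type
  [group : Group carrier]
  gen : Fin n → carrier
  closure_gen : Subgroup.closure (Set.range gen) = ⊤

attribute [instance] MarkedGroup.group

namespace MarkedGroup

variable {n : ℕ}

/-- The canonical epimorphism from the free group. -/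
def canon (M : MarkedGroup n) : FreeGroup (Fin n) →* M.carrier := FreeGroup.lift M.gen

theorem canon_surjective (M : MarkedGroup n) : Function.Surjective M.canon := by
  rw [← MonoidHom.range_eq_top, canon, FreeGroup.range_lift_eq_closure, M.closure_gen]

/-- Isomorphism of marked groups: a group isomorphism matching the ordered generators. -/
def Iso (M N : MarkedGroup n) : Prop :=
  ∃ e : M.carrier ≃* N.carrier, ∀ i, e (M.gen i) = N.gen i

instance setoid (n : ℕ) : Setoid (MarkedGroup n) where
  r := Iso
  iseqv :=
    { refl := fun M => ⟨MulEquiv.refl _, fun _ => rfl⟩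
      symm := fun ⟨e, he⟩ => ⟨e.symm, fun i => by rw [← he i, e.symm_apply_apply]⟩
      trans := fun ⟨e, he⟩ ⟨e', he'⟩ => ⟨e.trans e', fun i => by simp [he, he']⟩ }

theorem Iso.ker_eq {M N : MarkedGroup n} (h : Iso M N) : M.canon.ker = N.canon.ker := by
  obtain ⟨e, he⟩ := h
  have hc : N.canon = e.toMonoidHom.comp M.canon := by
    apply FreeGroup.ext_hom
    intro i
    simp [canon, he]
  ext w
  simp [MonoidHom.mem_ker, hc]

theorem iso_of_ker_eq {M N : MarkedGroup n} (h : M.canon.ker = N.canon.ker) : Iso M N := by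
  let e : M.carrier ≃* N.carrier :=
    ((QuotientGroup.quotientKerEquivOfSurjective M.canon M.canon_surjective).symm.trans
      (QuotientGroup.quotientMulEquivOfEq h)).trans
      (QuotientGroup.quotientKerEquivOfSurjective N.canon N.canon_surjective)
  have he : ∀ w, e (M.canon w) = N.canon w := by
    intro w
    have : (QuotientGroup.quotientKerEquivOfSurjective M.canon M.canon_surjective).symm
        (M.canon w) = (w : FreeGroup (Fin n) ⧸ M.canon.ker) := by
      rw [MulEquiv.symm_apply_eq]
      rfl
    simp only [e, MulEquiv.trans_apply, this]
    rfl
  refine ⟨e, fun i => ?_⟩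
  simpa [canon] using he (FreeGroup.of i)

/-- The free group with its standard basis, as a marked group. -/
def free (n : ℕ) : MarkedGroup n where
  carrier := FreeGroup (Fin n)
  gen := FreeGroup.of
  closure_gen := FreeGroup.closure_range_of _

end MarkedGroup

/-- The space `𝒢ₙ` of groups marked by `n` elements, up to isomorphism of marked groups. -/
def MarkedGroupSpace (n : ℕ) : Type 1 := Quotient (MarkedGroup.setoid n)

namespace MarkedGroupSpace

variable {n : ℕ}

/-- The point of `𝒢ₙ` given by a marked group. -/
def mk (M : MarkedGroup n) : MarkedGroupSpace n := Quotient.mk _ M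

/-- The relations of a marked group: the words in the free group that are trivial in it. -/
def relations (p : MarkedGroupSpace n) : Subgroup (FreeGroup (Fin n)) :=
  Quotient.lift (fun M : MarkedGroup n => M.canon.ker) (fun _ _ h => MarkedGroup.Iso.ker_eq h) p

/-- Two marked groups have the same relations of length at most `R`. -/
def SameRelations (R : ℕ) (p q : MarkedGroupSpace n) : Prop :=
  ∀ w : FreeGroup (Fin n), w.norm ≤ R → (w ∈ p.relations ↔ w ∈ q.relations)

/-- The distance of two marked groups is the infimum of the `e ^ (-R)` such that they have the same
relations of length at most `R`. -/
noncomputable instance : Dist (MarkedGroupSpace n) where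
  dist p q := sInf {d : ℝ | ∃ R : ℕ, SameRelations R p q ∧ d = Real.exp (-(R : ℝ))}

theorem dist_def (p q : MarkedGroupSpace n) :
    dist p q = sInf {d : ℝ | ∃ R : ℕ, SameRelations R p q ∧ d = Real.exp (-(R : ℝ))} := rfl

theorem bddBelow_dist (p q : MarkedGroupSpace n) :
    BddBelow {d : ℝ | ∃ R : ℕ, SameRelations R p q ∧ d = Real.exp (-(R : ℝ))} := by
  refine ⟨0, ?_⟩
  rintro d ⟨R, _, rfl⟩
  positivity

theorem nonempty_dist (p q : MarkedGroupSpace n) :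
    {d : ℝ | ∃ R : ℕ, SameRelations R p q ∧ d = Real.exp (-(R : ℝ))}.Nonempty := by
  refine ⟨_, 0, fun w hw => ?_, rfl⟩
  have : w = 1 := FreeGroup.norm_eq_zero.1 (Nat.le_zero.1 hw)
  subst this
  exact ⟨fun _ => one_mem _, fun _ => one_mem _⟩

/-- Two marked groups are at distance at most `e ^ (-R)` exactly if they have the same relations of
length at most `R`. -/
theorem dist_le_exp_iff (R : ℕ) (p q : MarkedGroupSpace n) :
    dist p q ≤ Real.exp (-(R : ℝ)) ↔ SameRelations R p q := by
  constructor
  · intro h w hw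
    have hlt : dist p q < Real.exp (-(R : ℝ) + 1) := lt_of_le_of_lt h (by simp)
    rw [dist_def, csInf_lt_iff (bddBelow_dist p q) (nonempty_dist p q)] at hlt
    obtain ⟨d, ⟨R', hR', rfl⟩, hd⟩ := hlt
    rw [Real.exp_lt_exp] at hd
    have : R < R' + 1 := by
      have : (R : ℝ) < R' + 1 := by linarith
      exact_mod_cast this
    exact hR' w (by omega)
  · intro h
    exact csInf_le (bddBelow_dist p q) ⟨R, h, rfl⟩

theorem relations_injective : Function.Injective (relations (n := n)) := by
  intro p q
  refine Quotient.inductionOn₂ p q fun M N h => ?_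
  exact Quotient.sound (MarkedGroup.iso_of_ker_eq h)

noncomputable instance : MetricSpace (MarkedGroupSpace n) where
  dist_self p := by
    refine le_antisymm ?_ ?_
    · have h : ∀ R : ℕ, dist p p ≤ Real.exp (-(R : ℝ)) := fun R =>
        (dist_le_exp_iff R p p).2 fun w _ => Iff.rfl
      exact ge_of_tendsto' (Real.tendsto_exp_neg_atTop_nhds_zero.comp
        tendsto_natCast_atTop_atTop) h
    · exact le_csInf (nonempty_dist p p) (by rintro d ⟨R, _, rfl⟩; positivity)
  dist_comm p q := by
    have h : ∀ R, SameRelations R p q ↔ SameRelations R q p := fun R =>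
      ⟨fun h w hw => (h w hw).symm, fun h w hw => (h w hw).symm⟩
    simp only [dist_def, h]
  dist_triangle p q r := by
    have h : ∀ R₁ R₂ : ℕ, SameRelations R₁ p q → SameRelations R₂ q r →
        dist p r ≤ Real.exp (-(R₁ : ℝ)) + Real.exp (-(R₂ : ℝ)) := by
      intro R₁ R₂ h₁ h₂
      rcases le_total R₁ R₂ with hle | hle
      · have := (dist_le_exp_iff R₁ p r).2 fun w hw => (h₁ w hw).trans (h₂ w (hw.trans hle))
        linarith [Real.exp_pos (-(R₂ : ℝ))]
      · have := (dist_le_exp_iff R₂ p r).2 fun w hw => (h₁ w (hw.trans hle)).trans (h₂ w hw)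
        linarith [Real.exp_pos (-(R₁ : ℝ))]
    have h' : dist p r - dist p q ≤ dist q r := by
      refine le_csInf (nonempty_dist q r) ?_
      rintro _ ⟨R₂, h₂, rfl⟩
      have : dist p r - Real.exp (-(R₂ : ℝ)) ≤ dist p q := by
        refine le_csInf (nonempty_dist p q) ?_
        rintro _ ⟨R₁, h₁, rfl⟩
        linarith [h R₁ R₂ h₁ h₂]
      linarith
    linarith
  eq_of_dist_eq_zero {p q} h := by
    apply relations_injective
    ext w
    exact (dist_le_exp_iff w.norm p q).1 (by rw [h]; positivity) w le_rfl

end MarkedGroupSpace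

/-! ## Fully residually `P` groups -/

/-- A finitely generated group `G` is fully residually `P` if for every finite collection of
nontrivial elements of `G` there is a surjective homomorphism from `G` to a group with property `P`
under which all their images are nontrivial. -/
def FullyResidually (P : (H : Type) → [Group H] → Prop) (G : Type) [Group G] : Prop :=
  Group.FG G ∧ ∀ W : Finset G, (∀ w ∈ W, w ≠ 1) →
    ∃ (H : Type) (_ : Group H), P H ∧
      ∃ φ : G →* H, Function.Surjective φ ∧ ∀ w ∈ W, φ w ≠ 1

/-- The property of being (isomorphic to) Thompson's group `F`. -/
def IsThompson (H : Type) [Group H] : Prop := Nonempty (H ≃* ThompsonF)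

/-! ## The markings of `F` -/

/-- The support of an element of `F`: the closure of the set of points that it moves. -/
def thompsonSupport (f : ThompsonF) : Set unitInterval := closure {x | f x ≠ x}

/-- The choice of `u_{1,m}, …, u_{l-2,m}` in `F`, for a given `m` and `ε`, with `l = k + 3` (so that
there are `k + 1` of them): every `u_{i,m}` is supported in `[0, ε)`, and for every nontrivial
reduced word `w` of length at most `2 m ^ 2` in the free group of rank `l - 1` on the letters
`a, b_1, …, b_{l-2}`, the element `w(x₀, u_{1,m}, …, u_{l-2,m})` is nontrivial on `[0, ε)`. -/
def IsAdmissible {k : ℕ} (m : ℕ) (ε : ℝ) (u : Fin (k + 1) → ThompsonF) : Prop :=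
  (∀ i, ∀ x ∈ thompsonSupport (u i), (x : ℝ) < ε) ∧
    ∀ w : FreeGroup (Fin (k + 2)), w ≠ 1 → w.norm ≤ 2 * m ^ 2 →
      ∃ x : unitInterval, (x : ℝ) < ε ∧
        (FreeGroup.lift (Fin.cons x0 u : Fin (k + 2) → ThompsonF) w) x ≠ x

/-- The ordered `l`-tuple `x₀, x₀ᵐ u₁ᵐ x₁, u₁, …, u_{l-2}` of elements of `F`, with `l = k + 3`. -/
noncomputable def thompsonMarking {k : ℕ} (m : ℕ) (u : Fin (k + 1) → ThompsonF) :
    Fin (k + 3) → ThompsonF :=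
  Fin.cons x0 (Fin.cons (x0 ^ m * u 0 ^ m * x1) u)

/-! ## Generation of Thompson's group by `x₀` and `x₁` -/

namespace ThompsonF

/-! Near `0` the group `F` leaves room for free behaviour. If a point starts in `[0, ε)`, a word of
length at most `m` in the marking keeps it below `2 ^ (m ^ 2) * ε < 1/2`: each letter enlarges
points by a factor of at most `2 ^ m`, and the `u i` fix everything beyond `ε`. There `x1` is the
identity, so the second generator acts as `x0 ^ m * u 0 ^ m` (`lift_thompsonMarking_apply`). A
relation `w` of the marking therefore yields a word in `x0` and the `u i`, of length at most `2 * m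
* w.norm`, acting trivially on `[0, ε)`.

That word is nontrivial when `w ≠ 1` is shorter than `m`: substituting `a ^ m * b ^ m` for one
letter creates blocks too long for the other letters to cancel (`FreeGroup.lift_ne_one`).
Admissibility then gives a point that it moves. So the marking has no nontrivial relation shorter
than `m`, which yields both the convergence and the residual property.

Admissible tuples come from one long reduced word `V` containing every short reduced word as an
infix. The `u i` and a non-dyadic point `p` are built along `V` so that the images of `p` under the
suffixes of `V` are pairwise distinct (`exists_isGeneric`); every infix then moves one of these
points.

Generation reduces to `x0` and `x1` generating `F`, as `x1` is recovered from the marking. An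
element of `F` maps some dyadic subdivision onto another with equally many intervals, and
rebracketing of binary trees, realised by copies of `x0` inside the group generated by `x0` and
`x1`, connects any two such subdivisions. -/

@[simp] theorem mul_apply (f g : ThompsonF) (x : unitInterval) : (f * g) x = f (g x) := rfl

@[simp] theorem inv_apply_self (f : ThompsonF) (x : unitInterval) : f⁻¹ (f x) = x :=
  f.1.symm_apply_apply x

@[simp] theorem apply_inv_self (f : ThompsonF) (x : unitInterval) : f (f⁻¹ x) = x :=
  f.1.apply_symm_apply x

theorem inv_apply_eq {f : ThompsonF} {x y : unitInterval} (h : f y = x) : f⁻¹ x = y := by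
  rw [← h, inv_apply_self]

theorem ext {f g : ThompsonF} (h : ∀ x, f x = g x) : f = g :=
  Subtype.ext (Homeomorph.ext h)

theorem strictMono (f : ThompsonF) : StrictMono f := f.2.1

theorem injective (f : ThompsonF) : Function.Injective f := (strictMono f).injective

theorem map_zero (f : ThompsonF) : f 0 = 0 := strictMono_map_zero f.2.1

theorem map_one (f : ThompsonF) : f 1 = 1 := by
  apply le_antisymm unitInterval.le_one'
  have h : f (f⁻¹ 1) ≤ f 1 := (strictMono f).monotone unitInterval.le_one'
  simpa using h

end ThompsonF

/-! ### Halves of `[0,1]` and the action of the generators on them -/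

/-- The affine map of `[0,1]` onto its left half. -/
noncomputable def leftHalf (x : unitInterval) : unitInterval :=
  ⟨x / 2, by have := x.2.1; have := x.2.2; constructor <;> linarith⟩

/-- The affine map of `[0,1]` onto its right half. -/
noncomputable def rightHalf (x : unitInterval) : unitInterval :=
  ⟨(1 + x) / 2, by have := x.2.1; have := x.2.2; constructor <;> linarith⟩

@[simp] theorem coe_leftHalf (x : unitInterval) : (leftHalf x : ℝ) = x / 2 := rfl

@[simp] theorem coe_rightHalf (x : unitInterval) : (rightHalf x : ℝ) = (1 + x) / 2 := rfl

theorem half_cases (x : unitInterval) : (∃ y, x = leftHalf y) ∨ ∃ y, x = rightHalf y := by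
  have h0 := x.2.1
  have h1 := x.2.2
  rcases le_total (x : ℝ) (1 / 2) with h | h
  · exact Or.inl ⟨⟨2 * x, by constructor <;> linarith⟩, Subtype.ext (by simp)⟩
  · exact Or.inr ⟨⟨2 * x - 1, by constructor <;> linarith⟩, Subtype.ext (by simp)⟩

theorem coe_x0 (x : unitInterval) : (x0 x : ℝ) = x0Fun x := rfl

theorem coe_x1 (x : unitInterval) : (x1 x : ℝ) = x1Fun x := rfl

theorem x0_left (x : unitInterval) : x0 (leftHalf x) = leftHalf (leftHalf x) := by
  have key : ∀ t : ℝ, t ≤ 1 → x0Fun (t / 2) = t / 2 / 2 := fun t h => by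
    rw [x0Fun, if_pos (by linarith)]
  exact Subtype.ext (key x x.2.2)

theorem x0_right_left (x : unitInterval) :
    x0 (rightHalf (leftHalf x)) = leftHalf (rightHalf x) := by
  have key : ∀ t : ℝ, 0 ≤ t → t ≤ 1 → x0Fun ((1 + t / 2) / 2) = (1 + t) / 2 / 2 :=
    fun t h0 h1 => by unfold x0Fun; split_ifs <;> linarith
  exact Subtype.ext (key x x.2.1 x.2.2)

theorem x0_right_right (x : unitInterval) : x0 (rightHalf (rightHalf x)) = rightHalf x := by
  have key : ∀ t : ℝ, 0 ≤ t → t ≤ 1 → x0Fun ((1 + (1 + t) / 2) / 2) = (1 + t) / 2 :=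
    fun t h0 h1 => by unfold x0Fun; split_ifs <;> linarith
  exact Subtype.ext (key x x.2.1 x.2.2)

theorem x1_left (x : unitInterval) : x1 (leftHalf x) = leftHalf x := by
  have key : ∀ t : ℝ, t ≤ 1 → x1Fun (t / 2) = t / 2 := fun t h => by
    rw [x1Fun, if_pos (by linarith)]
  exact Subtype.ext (key x x.2.2)

theorem x1_right (x : unitInterval) : x1 (rightHalf x) = rightHalf (x0 x) := by
  have key : ∀ t : ℝ, 0 ≤ t → x1Fun ((1 + t) / 2) = (1 + x0Fun t) / 2 := fun t h0 => by
    rw [x1Fun, show 2 * ((1 + t) / 2) - 1 = t by ring]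
    split_ifs with h
    · obtain rfl : t = 0 := by linarith
      norm_num [x0Fun]
    · rfl
  exact Subtype.ext (key x x.2.1)

/-- The subgroup of `F` generated by `x₀` and `x₁`. -/
noncomputable def stdSubgroup : Subgroup ThompsonF := Subgroup.closure {x0, x1}

theorem x0_mem_stdSubgroup : x0 ∈ stdSubgroup := Subgroup.subset_closure (by simp)

theorem x1_mem_stdSubgroup : x1 ∈ stdSubgroup := Subgroup.subset_closure (by simp)

/-- `k` is the identity on the left half and a rescaled copy of `h` on the right half. -/
def IsRightCopy (h k : ThompsonF) : Prop :=
  (∀ x, k (leftHalf x) = leftHalf x) ∧ ∀ x, k (rightHalf x) = rightHalf (h x)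

/-- `k` is the identity on the right half and a rescaled copy of `h` on the left half. -/
def IsLeftCopy (h k : ThompsonF) : Prop :=
  (∀ x, k (rightHalf x) = rightHalf x) ∧ ∀ x, k (leftHalf x) = leftHalf (h x)

/-- Rescaling into a half is compatible with products and inverses, so only copies of the two
generators have to be exhibited. -/
theorem exists_copy (C : ThompsonF → ThompsonF → Prop) (h0 : ∃ k ∈ stdSubgroup, C x0 k)
    (h1 : ∃ k ∈ stdSubgroup, C x1 k) (hone : C 1 1)
    (hmul : ∀ f g k l, C f k → C g l → C (f * g) (k * l))
    (hinv : ∀ f k, C f k → C f⁻¹ k⁻¹) {h : ThompsonF} (hh : h ∈ stdSubgroup) :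
    ∃ k ∈ stdSubgroup, C h k := by
  induction hh using Subgroup.closure_induction with
  | mem x hx =>
    rcases hx with rfl | rfl
    exacts [h0, h1]
  | one => exact ⟨1, one_mem _, hone⟩
  | mul f g _ _ hf hg =>
    obtain ⟨k, hk, hk'⟩ := hf
    obtain ⟨l, hl, hl'⟩ := hg
    exact ⟨k * l, mul_mem hk hl, hmul _ _ _ _ hk' hl'⟩
  | inv f _ hf =>
    obtain ⟨k, hk, hk'⟩ := hf
    exact ⟨k⁻¹, inv_mem hk, hinv _ _ hk'⟩

/-- `x1` is by construction the right copy of `x0`, and conjugating `x1` by `x0` pushes its support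
into the last quarter, which gives the right copy of `x1`. -/
theorem exists_isRightCopy {h : ThompsonF} (hh : h ∈ stdSubgroup) :
    ∃ k ∈ stdSubgroup, IsRightCopy h k := by
  refine exists_copy IsRightCopy ⟨x1, x1_mem_stdSubgroup, x1_left, x1_right⟩
    ⟨x0⁻¹ * x1 * x0, mul_mem (mul_mem (inv_mem x0_mem_stdSubgroup) x1_mem_stdSubgroup)
      x0_mem_stdSubgroup, fun x => ?_, fun x => ?_⟩ ⟨fun _ => rfl, fun _ => rfl⟩ ?_ ?_ hh
  · rw [ThompsonF.mul_apply, ThompsonF.mul_apply]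
    refine ThompsonF.inv_apply_eq ?_
    rw [x0_left, x1_left]
  · rw [ThompsonF.mul_apply, ThompsonF.mul_apply]
    refine ThompsonF.inv_apply_eq ?_
    rcases half_cases x with ⟨y, rfl⟩ | ⟨y, rfl⟩
    · rw [x1_left, x0_right_left, x1_left]
    · rw [x1_right, x0_right_right, x0_right_right, x1_right]
  · rintro f g k l ⟨h1, h2⟩ ⟨h3, h4⟩
    exact ⟨fun x => by simp [h1, h3], fun x => by simp [h2, h4]⟩
  · rintro f k ⟨h1, h2⟩
    exact ⟨fun x => ThompsonF.inv_apply_eq (h1 x),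
      fun x => ThompsonF.inv_apply_eq (by rw [h2, ThompsonF.apply_inv_self])⟩

theorem exists_isLeftCopy {h : ThompsonF} (hh : h ∈ stdSubgroup) :
    ∃ k ∈ stdSubgroup, IsLeftCopy h k := by
  -- Pentagon relation: on four subtrees, the left copy of `x0` rebrackets `(A(BC))D` to `((AB)C)D`.
  -- The other four sides of the pentagon pass through `A((BC)D)`, `A(B(CD))` and `(AB)(CD)`, by
  -- `x0⁻¹`, `x1⁻¹`, `x0`, `x0`.
  have hcopy : IsLeftCopy x0 (x0 * x0 * x1⁻¹ * x0⁻¹) := by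
    have hl : ∀ z, x1⁻¹ (leftHalf z) = leftHalf z := fun z =>
      ThompsonF.inv_apply_eq (x1_left z)
    refine ⟨fun x => ?_, fun x => ?_⟩
    · have h1 : x0⁻¹ (rightHalf x) = rightHalf (rightHalf x) :=
        ThompsonF.inv_apply_eq (x0_right_right x)
      have h2 : x1⁻¹ (rightHalf (rightHalf x)) = rightHalf (rightHalf (rightHalf x)) := 
        ThompsonF.inv_apply_eq (by rw [x1_right, x0_right_right])
      simp only [ThompsonF.mul_apply, h1, h2, x0_right_right]
    · rcases half_cases x with ⟨y, rfl⟩ | ⟨y, rfl⟩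
      · have h1 : x0⁻¹ (leftHalf (leftHalf y)) = leftHalf y :=
          ThompsonF.inv_apply_eq (x0_left y)
        simp only [ThompsonF.mul_apply, h1, hl, x0_left]
      · have h1 : x0⁻¹ (leftHalf (rightHalf y)) = rightHalf (leftHalf y) :=
          ThompsonF.inv_apply_eq (x0_right_left y)
        rcases half_cases y with ⟨z, rfl⟩ | ⟨z, rfl⟩
        · have h2 : x1⁻¹ (rightHalf (leftHalf (leftHalf z))) = rightHalf (leftHalf z) := 
            ThompsonF.inv_apply_eq (by rw [x1_right, x0_left])
          simp only [ThompsonF.mul_apply, h1, h2, x0_right_left, x0_left]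
        · have h2 : x1⁻¹ (rightHalf (leftHalf (rightHalf z))) =
              rightHalf (rightHalf (leftHalf z)) := 
            ThompsonF.inv_apply_eq (by rw [x1_right, x0_right_left])
          simp only [ThompsonF.mul_apply, h1, h2, x0_right_left, x0_right_right]
  have hmem : x0 * x0 * x1⁻¹ * x0⁻¹ ∈ stdSubgroup :=
    mul_mem (mul_mem (mul_mem x0_mem_stdSubgroup x0_mem_stdSubgroup)
      (inv_mem x1_mem_stdSubgroup)) (inv_mem x0_mem_stdSubgroup)
  -- `c` acts as a copy of `x0` on `[1/2, 3/4]`. Since `x0` carries this interval affinely onto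
  -- `[1/4, 1/2]`, the conjugate `x0 * c * x0⁻¹` is a copy of `x0` there, that is, the left copy of
  -- `x1`.
  obtain ⟨c, hc, hc1, hc2⟩ := exists_isRightCopy hmem
  refine exists_copy IsLeftCopy ⟨_, hmem, hcopy⟩
    ⟨x0 * c * x0⁻¹, mul_mem (mul_mem x0_mem_stdSubgroup hc) (inv_mem x0_mem_stdSubgroup),
      fun x => ?_, fun x => ?_⟩ ⟨fun _ => rfl, fun _ => rfl⟩ ?_ ?_ hh
  · have h1 : x0⁻¹ (rightHalf x) = rightHalf (rightHalf x) :=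
      ThompsonF.inv_apply_eq (x0_right_right x)
    rw [ThompsonF.mul_apply, ThompsonF.mul_apply, h1, hc2, hcopy.1, x0_right_right]
  · rcases half_cases x with ⟨y, rfl⟩ | ⟨y, rfl⟩
    · have h1 : x0⁻¹ (leftHalf (leftHalf y)) = leftHalf y :=
        ThompsonF.inv_apply_eq (x0_left y)
      rw [ThompsonF.mul_apply, ThompsonF.mul_apply, h1, hc1, x0_left, x1_left]
    · have h1 : x0⁻¹ (leftHalf (rightHalf y)) = rightHalf (leftHalf y) :=
        ThompsonF.inv_apply_eq (x0_right_left y)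
      rw [ThompsonF.mul_apply, ThompsonF.mul_apply, h1, hc2, hcopy.2, x0_right_left, x1_right]
  · rintro f g k l ⟨h1, h2⟩ ⟨h3, h4⟩
    exact ⟨fun x => by simp [h1, h3], fun x => by simp [h2, h4]⟩
  · rintro f k ⟨h1, h2⟩
    exact ⟨fun x => ThompsonF.inv_apply_eq (h1 x),
      fun x => ThompsonF.inv_apply_eq (by rw [h2, ThompsonF.apply_inv_self])⟩

/-! ### Dyadic subdivisions -/

/-- Finite binary trees, each describing a subdivision of `[0,1]` by repeated halving. -/
inductive DyadicTree : Type
  | leaf : DyadicTree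
  | node : DyadicTree → DyadicTree → DyadicTree

namespace DyadicTree

/-- The affine maps of `[0,1]` onto the intervals of the subdivision, from left to right. -/
noncomputable def leaves : DyadicTree → List (unitInterval → unitInterval)
  | leaf => [id]
  | node S T => S.leaves.map (leftHalf ∘ ·) ++ T.leaves.map (rightHalf ∘ ·)

/-- `f` maps the intervals of the subdivision `S` affinely onto those of `T`. -/
def Maps (f : ThompsonF) (S T : DyadicTree) : Prop :=
  S.leaves.map ((f : unitInterval → unitInterval) ∘ ·) = T.leaves

theorem Maps.mul {f g : ThompsonF} {S T U : DyadicTree} (hg : Maps g S T) (hf : Maps f T U) :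
    Maps (f * g) S U := by
  rw [Maps, ← hf, ← hg, List.map_map]
  rfl

theorem Maps.one (S : DyadicTree) : Maps 1 S S := List.map_id _

theorem Maps.inv {f : ThompsonF} {S T : DyadicTree} (h : Maps f S T) : Maps f⁻¹ T S := by
  rw [Maps, ← h, List.map_map]
  conv_rhs => rw [← List.map_id S.leaves]
  refine List.map_congr_left fun g _ => ?_
  funext x
  simp

theorem exists_leaf (T : DyadicTree) (x : unitInterval) : ∃ g ∈ T.leaves, ∃ y, x = g y := by
  induction T generalizing x with
  | leaf => exact ⟨id, by simp [leaves], x, rfl⟩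
  | node S T hS hT =>
    rcases half_cases x with ⟨y, rfl⟩ | ⟨y, rfl⟩
    · obtain ⟨g, hg, z, rfl⟩ := hS y
      refine ⟨leftHalf ∘ g, ?_, z, rfl⟩
      simp only [leaves, List.mem_append, List.mem_map]
      exact Or.inl ⟨g, hg, rfl⟩
    · obtain ⟨g, hg, z, rfl⟩ := hT y
      refine ⟨rightHalf ∘ g, ?_, z, rfl⟩
      simp only [leaves, List.mem_append, List.mem_map]
      exact Or.inr ⟨g, hg, rfl⟩

/-- The intervals of `S` cover `[0,1]`, and the affine map on each one is prescribed. -/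
theorem Maps.unique {f g : ThompsonF} {S T : DyadicTree} (hf : Maps f S T) (hg : Maps g S T) :
    f = g := by
  refine ThompsonF.ext fun x => ?_
  obtain ⟨l, hl, y, rfl⟩ := S.exists_leaf x
  have h := List.map_inj_left.1 (hf.trans hg.symm) l hl
  exact congrFun h y

theorem Maps.node_left {h k : ThompsonF} {S T : DyadicTree} (U : DyadicTree) (hk : IsLeftCopy h k)
    (hST : Maps h S T) : Maps k (node S U) (node T U) := by
  simp only [Maps, leaves, List.map_append, List.map_map]
  congr 1
  · rw [← hST, List.map_map]
    exact List.map_congr_left fun g _ => funext fun x => hk.2 (g x)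
  · exact List.map_congr_left fun g _ => funext fun x => hk.1 (g x)

theorem Maps.node_right {h k : ThompsonF} {S T : DyadicTree} (U : DyadicTree)
    (hk : IsRightCopy h k) (hST : Maps h S T) : Maps k (node U S) (node U T) := by
  simp only [Maps, leaves, List.map_append, List.map_map]
  congr 1
  · exact List.map_congr_left fun g _ => funext fun x => hk.1 (g x)
  · rw [← hST, List.map_map]
    exact List.map_congr_left fun g _ => funext fun x => hk.2 (g x)

/-- `x0` is a rotation of trees; this makes associativity of `node` available in `Rel`. -/
theorem maps_x0 (A B C : DyadicTree) : Maps x0 (node A (node B C)) (node (node A B) C) := by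
  simp only [Maps, leaves, List.map_append, List.map_map, List.append_assoc]
  congr 1
  · exact List.map_congr_left fun g _ => funext fun x => x0_left (g x)
  · congr 1
    · exact List.map_congr_left fun g _ => funext fun x => x0_right_left (g x)
    · exact List.map_congr_left fun g _ => funext fun x => x0_right_right (g x)

/-- Two subdivisions are related if an element of the subgroup generated by `x₀`, `x₁` maps one to
the other. -/
def Rel (S T : DyadicTree) : Prop := ∃ h ∈ stdSubgroup, Maps h S T

theorem Rel.refl (S : DyadicTree) : Rel S S := ⟨1, one_mem _, Maps.one S⟩

theorem Rel.trans {S T U : DyadicTree} : Rel S T → Rel T U → Rel S U :=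
  fun ⟨h, hh, hST⟩ ⟨k, hk, hTU⟩ => ⟨k * h, mul_mem hk hh, hST.mul hTU⟩

theorem Rel.symm {S T : DyadicTree} : Rel S T → Rel T S :=
  fun ⟨h, hh, hST⟩ => ⟨h⁻¹, inv_mem hh, hST.inv⟩

theorem Rel.node {S S' T T' : DyadicTree} : Rel S S' → Rel T T' → Rel (node S T) (node S' T') := by
  rintro ⟨h, hh, hS⟩ ⟨k, hk, hT⟩
  obtain ⟨h', hh', hc⟩ := exists_isLeftCopy hh
  obtain ⟨k', hk', hc'⟩ := exists_isRightCopy hk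
  exact Rel.trans ⟨h', hh', hS.node_left T hc⟩ ⟨k', hk', hT.node_right S' hc'⟩

theorem Rel.assoc (A B C : DyadicTree) : Rel (.node (.node A B) C) (.node A (.node B C)) :=
  Rel.symm ⟨x0, x0_mem_stdSubgroup, maps_x0 A B C⟩

/-- The tree with `n + 1` leaves in which only right halves are subdivided. -/
def comb : ℕ → DyadicTree
  | 0 => leaf
  | n + 1 => node leaf (comb n)

theorem rel_node_comb (a b : ℕ) : Rel (node (comb a) (comb b)) (comb (a + b + 1)) := by
  induction a with
  | zero => rw [Nat.zero_add]; exact Rel.refl _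
  | succ a ih =>
    rw [show a + 1 + b + 1 = (a + b + 1) + 1 by omega]
    exact (Rel.assoc leaf (comb a) (comb b)).trans ((Rel.refl leaf).node ih)

theorem length_leaves_comb (n : ℕ) : (comb n).leaves.length = n + 1 := by
  induction n with
  | zero => rfl
  | succ n ih => simp only [comb, leaves, List.length_append, List.length_map, ih]; simp; omega

theorem exists_rel_comb (T : DyadicTree) : ∃ n, Rel T (comb n) := by
  induction T with
  | leaf => exact ⟨0, Rel.refl _⟩
  | node S T hS hT =>
    obtain ⟨a, ha⟩ := hS
    obtain ⟨b, hb⟩ := hT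
    exact ⟨_, (ha.node hb).trans (rel_node_comb a b)⟩

theorem Maps.length_eq {f : ThompsonF} {S T : DyadicTree} (h : Maps f S T) :
    S.leaves.length = T.leaves.length := by
  rw [← h, List.length_map]

/-- Associativity brings every tree to a comb, and combs are determined by their number of leaves.
-/
theorem rel_of_length_eq {S T : DyadicTree} (h : S.leaves.length = T.leaves.length) :
    Rel S T := by
  obtain ⟨a, f, hf, hS⟩ := S.exists_rel_comb
  obtain ⟨b, g, hg, hT⟩ := T.exists_rel_comb
  have h1 := hS.length_eq
  have h2 := hT.length_eq
  rw [length_leaves_comb] at h1 h2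
  obtain rfl : a = b := by omega
  exact Rel.trans ⟨f, hf, hS⟩ (Rel.symm ⟨g, hg, hT⟩)

theorem Maps.mem_stdSubgroup {f : ThompsonF} {S T : DyadicTree} (h : Maps f S T) :
    f ∈ stdSubgroup := by
  obtain ⟨g, hg, hST⟩ := rel_of_length_eq h.length_eq
  rwa [h.unique hST]

/-! ### Every element of `F` maps a dyadic subdivision to another one -/

/-- Each interval begins where the previous one ends, from `x` to `y`. -/
def IsPath : List (unitInterval → unitInterval) → unitInterval → unitInterval → Prop
  | [], x, y => x = y
  | g :: l, x, y => g 0 = x ∧ IsPath l (g 1) y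

theorem IsPath.append {l l' : List (unitInterval → unitInterval)} {x y z : unitInterval}
    (h : IsPath l x y) (h' : IsPath l' y z) : IsPath (l ++ l') x z := by
  induction l generalizing x with
  | nil => rw [IsPath] at h; rwa [h]
  | cons g l ih => exact ⟨h.1, ih h.2⟩

theorem IsPath.map (f : unitInterval → unitInterval) {l : List (unitInterval → unitInterval)}
    {x y : unitInterval} (h : IsPath l x y) : IsPath (l.map (f ∘ ·)) (f x) (f y) := by
  induction l generalizing x with
  | nil => exact congrArg f h
  | cons g l ih => exact ⟨congrArg f h.1, ih h.2⟩

theorem isPath_leaves (T : DyadicTree) : IsPath T.leaves 0 1 := by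
  induction T with
  | leaf => exact ⟨rfl, rfl⟩
  | node S T hS hT =>
    have h0 : leftHalf 0 = 0 := Subtype.ext (by simp)
    have h1 : rightHalf 1 = 1 := Subtype.ext (by simp)
    have h2 : rightHalf 0 = leftHalf 1 := Subtype.ext (by simp)
    have hl := hS.map leftHalf
    have hr := hT.map rightHalf
    rw [h0] at hl
    rw [h1, h2] at hr
    exact hl.append hr

/-- `g` is the affine map of `[0,1]` onto a standard dyadic interval of length `2 ^ (-n)`. -/
def IsStandard (n : ℕ) (g : unitInterval → unitInterval) : Prop :=
  ∃ c : ℤ, ∀ x, (g x : ℝ) = (c + x) / 2 ^ n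

theorem IsStandard.eq {n : ℕ} {g g' : unitInterval → unitInterval} (hg : IsStandard n g)
    (hg' : IsStandard n g') (h : g 0 = g' 0) : g = g' := by
  obtain ⟨c, hc⟩ := hg
  obtain ⟨d, hd⟩ := hg'
  have h0 : (g 0 : ℝ) = g' 0 := by rw [h]
  rw [hc, hd] at h0
  have : (c : ℝ) = d := by
    have h2 : (0 : ℝ) < 2 ^ n := by positivity
    field_simp at h0
    simpa using h0
  funext x
  exact Subtype.ext (by rw [hc, hd, this])

theorem IsStandard.lt {n : ℕ} {g : unitInterval → unitInterval} (hg : IsStandard n g) :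
    g 0 < g 1 := by
  obtain ⟨c, hc⟩ := hg
  rw [← Subtype.coe_lt_coe, hc, hc]
  gcongr
  simp

theorem IsPath.le {n : ℕ} {l : List (unitInterval → unitInterval)} {x y : unitInterval}
    (h : IsPath l x y) (hl : ∀ g ∈ l, IsStandard n g) : x ≤ y := by
  induction l generalizing x with
  | nil => exact le_of_eq h
  | cons g l ih =>
    rw [← h.1]
    exact (hl g (by simp)).lt.le.trans (ih h.2 fun g' hg' => hl g' (by simp [hg']))

/-- At a fixed level a standard interval is determined by its left endpoint, so the list is forced
from left to right. -/
theorem IsPath.unique {n : ℕ} {l l' : List (unitInterval → unitInterval)} {x y : unitInterval}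
    (h : IsPath l x y) (h' : IsPath l' x y) (hl : ∀ g ∈ l, IsStandard n g)
    (hl' : ∀ g ∈ l', IsStandard n g) : l = l' := by
  induction l generalizing x l' with
  | nil =>
    cases l' with
    | nil => rfl
    | cons g l' =>
      have h1 := (hl' g (by simp)).lt
      have h2 := IsPath.le h'.2 fun g' hg' => hl' g' (by simp [hg'])
      have h3 : x = y := h
      rw [h'.1, h3] at h1
      exact absurd h1 (not_lt.2 h2)
  | cons g l ih =>
    cases l' with
    | nil =>
      have h1 := (hl g (by simp)).lt
      have h2 := IsPath.le h.2 fun g' hg' => hl g' (by simp [hg'])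
      have h3 : x = y := h'
      rw [h.1, h3] at h1
      exact absurd h1 (not_lt.2 h2)
    | cons g' l' =>
      obtain rfl := (hl g (by simp)).eq (hl' g' (by simp)) (h.1.trans h'.1.symm)
      rw [ih h.2 h'.2 (fun g' hg' => hl g' (by simp [hg'])) fun g' hg' => hl' g' (by simp [hg'])]

/-- The tree of all standard dyadic intervals of length `2 ^ (-n)`. -/
def complete : ℕ → DyadicTree
  | 0 => leaf
  | n + 1 => node (complete n) (complete n)

theorem isStandard_of_mem_leaves_complete {n : ℕ} {g : unitInterval → unitInterval}
    (hg : g ∈ (complete n).leaves) : IsStandard n g := by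
  induction n generalizing g with
  | zero =>
    simp only [complete, leaves, List.mem_singleton] at hg
    subst hg
    exact ⟨0, by simp⟩
  | succ n ih =>
    simp only [complete, leaves, List.mem_append, List.mem_map] at hg
    rcases hg with ⟨g, hg, rfl⟩ | ⟨g, hg, rfl⟩
    · obtain ⟨c, hc⟩ := ih hg
      exact ⟨c, fun x => by simp only [Function.comp, coe_leftHalf, hc, pow_succ]; field_simp⟩
    · obtain ⟨c, hc⟩ := ih hg
      refine ⟨2 ^ n + c, fun x => ?_⟩
      simp only [Function.comp, coe_rightHalf, hc]
      push_cast
      field_simp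
      ring

/-- Refinements of the separate leaves are grafted onto `T`. Asking for them at all large `N` lets
the finitely many leaves agree on a single `N`. -/
theorem eventually_exists_refinement (Q : ℕ → (unitInterval → unitInterval) → Prop)
    (T : DyadicTree)
    (h : ∀ g ∈ T.leaves, ∀ᶠ N in atTop, ∃ S : DyadicTree, ∀ l ∈ S.leaves, Q N (g ∘ l)) :
    ∀ᶠ N in atTop, ∃ S : DyadicTree, ∀ l ∈ S.leaves, Q N l := by
  induction T generalizing Q with
  | leaf => exact h id (by simp [leaves])
  | node A B hA hB =>
    simp only [leaves, List.mem_append, List.mem_map] at h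
    have h1 := hA (fun N g => Q N (leftHalf ∘ g)) fun g hg => h (leftHalf ∘ g) (Or.inl ⟨g, hg, rfl⟩)
    have h2 := hB (fun N g => Q N (rightHalf ∘ g))
      fun g hg => h (rightHalf ∘ g) (Or.inr ⟨g, hg, rfl⟩)
    filter_upwards [h1, h2] with N ⟨S, hS⟩ ⟨S', hS'⟩
    refine ⟨node S S', fun l hl => ?_⟩
    simp only [leaves, List.mem_append, List.mem_map] at hl
    rcases hl with ⟨l, hl, rfl⟩ | ⟨l, hl, rfl⟩
    exacts [hS l hl, hS' l hl]

/-- On each interval of a fine enough complete subdivision `f` is affine with slope a power of `2`.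
Cutting the interval into equal parts makes the images standard of a common length `2 ^ (-N)`; as
they run from `0` to `1`, they are exactly the intervals of `complete N`. -/
theorem exists_maps (f : ThompsonF) : ∃ S T : DyadicTree, Maps f S T := by
  obtain ⟨B, hB, hlin⟩ := f.2.2
  have hlevel : ∀ᶠ n : ℕ in atTop, ∀ b ∈ B, ∃ a : ℤ, (b : ℝ) = a / 2 ^ n := by
    rw [Filter.eventually_all_finset]
    intro b hb
    obtain ⟨a, n, han⟩ := hB b hb
    filter_upwards [eventually_ge_atTop n] with m hm
    obtain ⟨d, rfl⟩ := Nat.exists_eq_add_of_le hm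
    refine ⟨a * 2 ^ d, ?_⟩
    rw [han]
    push_cast
    rw [pow_add]
    field_simp
  obtain ⟨n, hn⟩ := hlevel.exists
  have key : ∀ᶠ N : ℕ in atTop, ∃ S : DyadicTree, ∀ l ∈ S.leaves,
      IsStandard N ((f : unitInterval → unitInterval) ∘ l) := by
    refine eventually_exists_refinement
      (fun N l => IsStandard N ((f : unitInterval → unitInterval) ∘ l)) (complete n) fun g hg => ?_
    have hst := isStandard_of_mem_leaves_complete hg
    have hlt := hst.lt
    obtain ⟨c, hc⟩ := hst
    obtain ⟨k, hk⟩ := hlin (g 0) (g 1) hlt (by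
      rintro b hb ⟨h1, h2⟩
      obtain ⟨a, ha⟩ := hn b hb
      rw [← Subtype.coe_lt_coe, hc, ha] at h1 h2
      have hp : (0 : ℝ) < 2 ^ n := by positivity
      rw [div_lt_div_iff_of_pos_right hp] at h1 h2
      have h1' : c < a := by exact_mod_cast (by simpa using h1 : (c : ℝ) < a)
      have h2' : a < c + 1 := by exact_mod_cast (by simpa using h2 : (a : ℝ) < c + 1)
      omega)
    have hd : IsDyadic (g 0 : ℝ) := ⟨c, n, by rw [hc]; simp⟩
    obtain ⟨A, M, hAM⟩ := f.2.2.map_dyadic f.2.1 _ hd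
    filter_upwards [eventually_ge_atTop M, eventually_ge_atTop ((n : ℤ) - k).toNat] with N hN1 hN2
    -- An interval of length `2 ^ (-n)` with slope `2 ^ k` must be halved `e = N - n + k` times for
    -- its pieces to have images of length `2 ^ (-N)`. The condition `M ≤ N` makes the left endpoint
    -- of the image a multiple of `2 ^ (-N)`.
    obtain ⟨e, he⟩ : ∃ e : ℕ, (N : ℤ) = n - k + e := ⟨(N - (n - k)).toNat, by omega⟩
    refine ⟨complete e, fun l hl => ?_⟩
    obtain ⟨j, hj⟩ := isStandard_of_mem_leaves_complete hl
    obtain ⟨d, rfl⟩ := Nat.exists_eq_add_of_le hN1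
    refine ⟨A * 2 ^ d + j, fun x => ?_⟩
    have hmono : Monotone g := fun a b hab => by
      rw [← Subtype.coe_le_coe, hc, hc]
      have : (a : ℝ) ≤ b := hab
      gcongr
    have h2k : (2 : ℝ) ^ (M + d) = 2 ^ n / 2 ^ k * 2 ^ e := by
      rw [← zpow_natCast, he, zpow_add₀ two_ne_zero, zpow_sub₀ two_ne_zero, zpow_natCast,
        zpow_natCast]
    have h := hk (g (l x)) (hmono unitInterval.nonneg') (hmono unitInterval.le_one')
    have hAM' : (f (g 0) : ℝ) = (A : ℝ) / 2 ^ M := hAM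
    change (f (g (l x)) : ℝ) = _
    rw [show (f (g (l x)) : ℝ) = (f (g 0) : ℝ) + 2 ^ k * ((g (l x) : ℝ) - (g 0 : ℝ)) from h,
      hAM', hc, hc, hj]
    push_cast
    have h1 : (A : ℝ) / 2 ^ M = A * 2 ^ d / 2 ^ (M + d) := by rw [pow_add]; field_simp
    have h2 : (2 : ℝ) ^ k * ((c + (j + x) / 2 ^ e) / 2 ^ n - (c + 0) / 2 ^ n) =
        (j + x) / 2 ^ (M + d) := by
      rw [h2k]
      have : (2 : ℝ) ^ k ≠ 0 := by positivity
      field_simp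
      ring
    rw [h1, h2]
    ring
  obtain ⟨N, S, hS⟩ := key.exists
  refine ⟨S, complete N, IsPath.unique (n := N) (x := 0) (y := 1) ?_ (isPath_leaves _) ?_
    fun g hg => isStandard_of_mem_leaves_complete hg⟩
  · have := S.isPath_leaves.map f
    rwa [ThompsonF.map_zero, ThompsonF.map_one] at this
  · intro g hg
    obtain ⟨l, hl, rfl⟩ := List.mem_map.1 hg
    exact hS l hl

end DyadicTree

theorem stdSubgroup_eq_top : stdSubgroup = ⊤ := by
  refine (Subgroup.eq_top_iff' _).2 fun f => ?_
  obtain ⟨S, T, h⟩ := DyadicTree.exists_maps f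
  exact h.mem_stdSubgroup

/-! ## Approximating a free group by a free group of smaller rank -/

namespace FreeGroup

/-- The sign of an exponent. -/
def expSign (e : Bool) : ℤ := cond e 1 (-1)

theorem cond_of_eq_zpow {ι : Type*} (i : ι) (e : Bool) :
    cond e (of i) (of i)⁻¹ = of i ^ expSign e := by
  cases e <;> simp [expSign]

variable {ι : Type*} [DecidableEq ι]

/-- The exponent of the leading syllable of `g` if this syllable is a power of the `i`-th basis
element, and `0` otherwise. -/
def leadExp (i : ι) (g : FreeGroup ι) : ℤ :=
  Multiplicative.toAdd (Monoid.CoprodI.Word.equivPair i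
    (lift (fun j => Monoid.CoprodI.of (M := fun _ : ι => Multiplicative ℤ) (i := j)
      (Multiplicative.ofAdd 1)) g • (Monoid.CoprodI.Word.empty (M := fun _ : ι =>
        Multiplicative ℤ)))).head

theorem leadExp_one (i : ι) : leadExp i (1 : FreeGroup ι) = 0 := by
  rw [leadExp, _root_.map_one, one_smul, Monoid.CoprodI.Word.equivPair_eq_of_fstIdx_ne (by
    simp [Monoid.CoprodI.Word.fstIdx])]
  rfl

/-- Reading the exponent from the normal form in a free product of copies of `ℤ` makes it additive
whether or not cancellation occurs. -/
theorem leadExp_zpow_mul (i : ι) (n : ℤ) (g : FreeGroup ι) :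
    leadExp i (of i ^ n * g) = n + leadExp i g := by
  rw [leadExp, _root_.map_mul, _root_.map_zpow, lift_apply_of, ← _root_.map_zpow, mul_smul,
    Monoid.CoprodI.Word.equivPair_smul_same, toAdd_mul, toAdd_zpow, toAdd_ofAdd, leadExp]
  simp

theorem leadExp_eq_zero {i j : ι} {g : FreeGroup ι} (h : leadExp i g ≠ 0) (hij : i ≠ j) :
    leadExp j g = 0 := by
  have aux : ∀ l : ι, leadExp l g ≠ 0 → (lift (fun j => Monoid.CoprodI.of
      (M := fun _ : ι => Multiplicative ℤ) (i := j) (Multiplicative.ofAdd 1)) g •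
      (Monoid.CoprodI.Word.empty (M := fun _ : ι => Multiplicative ℤ))).fstIdx = some l := by
    intro l hl
    by_contra hne
    rw [leadExp, Monoid.CoprodI.Word.equivPair_eq_of_fstIdx_ne hne] at hl
    exact hl rfl
  by_contra hj
  have := (aux i h).symm.trans (aux j hj)
  exact hij (Option.some_injective _ this)

/-! ### Leading syllables after substituting `a ^ m * b ^ m` for a letter -/

theorem lift_mk_cons {κ G : Type*} [Group G] (f : κ → G) (p : κ × Bool) (L : List (κ × Bool)) :
    lift f (mk (p :: L)) = cond p.2 (f p.1) (f p.1)⁻¹ * lift f (mk L) := by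
  simp only [lift_mk, List.map_cons, List.prod_cons]

variable {κ : Type*} {σ : κ → ι} {y : κ} {a b : ι} {m : ℕ}

/-- What is known of the leading syllable of the image of a reduced word with `n` letters and first
letter `p`, if the letter `y` is sent to `a ^ m * b ^ m` and the other letters to basis elements. -/
def LeadsWith (σ : κ → ι) (y : κ) (a b : ι) (m n : ℕ) (p : κ × Bool) (g : FreeGroup ι) : Prop :=
  (p.1 = y ∧ ((p.2 = true ∧ leadExp a g = m) ∨ (p.2 = false ∧ leadExp b g = -m))) ∨
  (p.1 ≠ y ∧ ((0 < expSign p.2 * leadExp (σ p.1) g ∧ expSign p.2 * leadExp (σ p.1) g ≤ n) ∨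
    ∃ t : ℤ, ((σ p.1 = a ∧ t = m) ∨ (σ p.1 = b ∧ t = -m)) ∧
      0 < expSign p.2 * (leadExp (σ p.1) g - t) ∧ expSign p.2 * (leadExp (σ p.1) g - t) ≤ n))

/-- The exponent is `t ± j` with `t` one of `0`, `m`, `-m` and `0 < j ≤ n < m`, hence nonzero. -/
theorem LeadsWith.leadExp_ne_zero {n : ℕ} (hnm : n < m) {p : κ × Bool} {g : FreeGroup ι}
    (h : LeadsWith σ y a b m n p g) (hp : p.1 ≠ y) : leadExp (σ p.1) g ≠ 0 := by
  rcases h with ⟨h, -⟩ | ⟨-, ⟨h, -⟩ | ⟨t, ht, h1, h2⟩⟩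
  · exact absurd h hp
  · intro h0
    simp [h0] at h
  · intro h0
    rw [h0] at h1 h2
    rcases p with ⟨x, _ | _⟩ <;> simp only [expSign, cond] at h1 h2 <;>
      rcases ht with ⟨-, rfl⟩ | ⟨-, rfl⟩ <;> omega

theorem LeadsWith.ne_one {n : ℕ} (hnm : n < m) {p : κ × Bool} {g : FreeGroup ι}
    (h : LeadsWith σ y a b m n p g) : g ≠ 1 := by
  rintro rfl
  by_cases hp : p.1 = y
  · rcases h with ⟨-, ⟨-, h⟩ | ⟨-, h⟩⟩ | ⟨h, -⟩
    · rw [leadExp_one] at h; omega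
    · rw [leadExp_one] at h; omega
    · exact h hp
  · exact h.leadExp_ne_zero hnm hp (leadExp_one _)

/-- Rules out that a preceding `a ^ (-m)`, the end of the image of `y⁻¹`, cancels a whole syllable:
only a word beginning with `y` itself has leading syllable `a ^ m`. -/
theorem LeadsWith.leadExp_ne_left {n : ℕ} (hnm : n < m) (hab : a ≠ b) {p : κ × Bool}
    {g : FreeGroup ι} (h : LeadsWith σ y a b m n p g) (hp : p.1 = y → p.2 = false) :
    leadExp a g ≠ m := by
  intro h0
  by_cases hy : p.1 = y
  · rcases h with ⟨-, ⟨h, -⟩ | ⟨-, h⟩⟩ | ⟨h, -⟩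
    · simp [hp hy] at h
    · rw [leadExp_eq_zero (i := b) (by omega) hab.symm] at h0
      omega
    · exact h hy
  · have hne := h.leadExp_ne_zero hnm hy
    by_cases hσ : σ p.1 = a
    · rw [LeadsWith, hσ] at h
      rcases h with ⟨h, -⟩ | ⟨-, ⟨h1, h2⟩ | ⟨t, ht, h1, h2⟩⟩
      · exact hy h
      · rw [h0] at h1 h2
        rcases p with ⟨x, _ | _⟩ <;> simp only [expSign, cond] at h1 h2 <;> omega
      · rcases ht with ⟨-, rfl⟩ | ⟨h, -⟩
        · simp [h0] at h1
        · exact hab h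
    · rw [leadExp_eq_zero hne hσ] at h0
      omega

/-- The mirror image, for a preceding `b ^ m` at the end of the image of `y`. -/
theorem LeadsWith.leadExp_ne_right {n : ℕ} (hnm : n < m) (hab : a ≠ b) {p : κ × Bool}
    {g : FreeGroup ι} (h : LeadsWith σ y a b m n p g) (hp : p.1 = y → p.2 = true) :
    leadExp b g ≠ -m := by
  intro h0
  by_cases hy : p.1 = y
  · rcases h with ⟨-, ⟨-, h⟩ | ⟨h, -⟩⟩ | ⟨h, -⟩
    · rw [leadExp_eq_zero (i := a) (by omega) hab] at h0
      omega
    · simp [hp hy] at h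
    · exact h hy
  · have hne := h.leadExp_ne_zero hnm hy
    by_cases hσ : σ p.1 = b
    · rw [LeadsWith, hσ] at h
      rcases h with ⟨h, -⟩ | ⟨-, ⟨h1, h2⟩ | ⟨t, ht, h1, h2⟩⟩
      · exact hy h
      · rw [h0] at h1 h2
        rcases p with ⟨x, _ | _⟩ <;> simp only [expSign, cond] at h1 h2 <;> omega
      · rcases ht with ⟨h, -⟩ | ⟨-, rfl⟩
        · exact hab h.symm
        · simp [h0] at h1
    · rw [leadExp_eq_zero hne hσ] at h0
      omega

/-- Letters are prepended one at a time. In front of a letter `y` or `y⁻¹`, the inner block never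
cancels a full syllable of the rest, so the outer block survives with exponent exactly `m` or `-m`.
Any other letter extends a run of equal letters, starts a new syllable, or eats into a block left by
`y` or `y⁻¹`; the last case is recorded by the offset `t`, and a run shorter than `m` cannot exhaust
the block. -/
theorem leadsWith_lift (hσ : Set.InjOn σ {y}ᶜ) (hab : a ≠ b) {φ : κ → FreeGroup ι}
    (hy : φ y = of a ^ m * of b ^ m) (hφ : ∀ x ≠ y, φ x = of (σ x)) {L : List (κ × Bool)}
    {p : κ × Bool} (hL : IsReduced (p :: L)) (hm : L.length + 1 < m) :
    LeadsWith σ y a b m (L.length + 1) p (lift φ (mk (p :: L))) := by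
  induction L generalizing p with
  | nil =>
    rcases p with ⟨x, e⟩
    rw [lift_mk_cons, ← one_eq_mk, _root_.map_one]
    by_cases hx : x = y
    · subst hx
      refine Or.inl ⟨rfl, ?_⟩
      cases e
      · refine Or.inr ⟨rfl, ?_⟩
        have h1 : leadExp a (of a ^ (-m : ℤ) * 1) = -m := by
          rw [leadExp_zpow_mul, leadExp_one, add_zero]
        have h2 : leadExp b (of a ^ (-m : ℤ) * 1) = 0 := leadExp_eq_zero (i := a) (by omega) hab
        have h3 := leadExp_zpow_mul b (-m) (of a ^ (-m : ℤ) * 1)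
        rw [h2] at h3
        simpa [hy] using h3
      · refine Or.inl ⟨rfl, ?_⟩
        have h1 : leadExp b (of b ^ (m : ℤ) * 1) = m := by
          rw [leadExp_zpow_mul, leadExp_one, add_zero]
        have h2 : leadExp a (of b ^ (m : ℤ) * 1) = 0 :=
          leadExp_eq_zero (i := b) (by omega) hab.symm
        have h3 := leadExp_zpow_mul a m (of b ^ (m : ℤ) * 1)
        rw [h2] at h3
        simpa [hy] using h3
    · refine Or.inr ⟨hx, Or.inl ?_⟩
      simp only [hφ x hx, cond_of_eq_zpow, leadExp_zpow_mul, leadExp_one]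
      cases e <;> simp [expSign]
  | cons q L ih =>
    rw [isReduced_cons_cons] at hL
    simp only [List.length_cons] at hm
    have hq := ih hL.2 (by omega)
    have hlt : L.length + 1 < m := by omega
    rw [lift_mk_cons]
    generalize lift φ (mk (q :: L)) = g at hq ⊢
    rcases p with ⟨x, e⟩
    by_cases hx : x = y
    · subst hx
      refine Or.inl ⟨rfl, ?_⟩
      cases e
      · refine Or.inr ⟨rfl, ?_⟩
        have h0 := hq.leadExp_ne_left hlt hab fun h => (hL.1 h.symm).symm
        have h1 := leadExp_zpow_mul a (-m) g
        have h2 : leadExp b (of a ^ (-m : ℤ) * g) = 0 := leadExp_eq_zero (i := a) (by omega) hab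
        have h3 := leadExp_zpow_mul b (-m) (of a ^ (-m : ℤ) * g)
        rw [h2] at h3
        simpa [hy, mul_assoc] using h3
      · refine Or.inl ⟨rfl, ?_⟩
        have h0 := hq.leadExp_ne_right hlt hab fun h => (hL.1 h.symm).symm
        have h1 := leadExp_zpow_mul b m g
        have h2 : leadExp a (of b ^ (m : ℤ) * g) = 0 :=
          leadExp_eq_zero (i := b) (by omega) hab.symm
        have h3 := leadExp_zpow_mul a m (of b ^ (m : ℤ) * g)
        rw [h2] at h3
        simpa [hy, mul_assoc] using h3
    · refine Or.inr ⟨hx, ?_⟩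
      simp only [hφ x hx, cond_of_eq_zpow, leadExp_zpow_mul, List.length_cons]
      have hone : expSign e * expSign e = 1 := by cases e <;> rfl
      by_cases hqy : q.1 = y
      · rcases hq with ⟨-, ⟨-, h⟩ | ⟨-, h⟩⟩ | ⟨h, -⟩
        · by_cases hσa : σ x = a
          · refine Or.inr ⟨m, Or.inl ⟨hσa, rfl⟩, ?_⟩
            rw [hσa, h, add_sub_cancel_right, hone]
            omega
          · rw [leadExp_eq_zero (i := a) (by omega) (Ne.symm hσa), add_zero, hone]
            left; omega
        · by_cases hσb : σ x = b
          · refine Or.inr ⟨-m, Or.inr ⟨hσb, rfl⟩, ?_⟩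
            rw [hσb, h, add_sub_cancel_right, hone]
            omega
          · rw [leadExp_eq_zero (i := b) (by omega) (Ne.symm hσb), add_zero, hone]
            left; omega
        · exact absurd hqy h
      · by_cases hσx : σ q.1 = σ x
        · obtain rfl : q.1 = x := hσ hqy hx hσx
          obtain rfl : e = q.2 := hL.1 rfl
          rcases hq with ⟨h, -⟩ | ⟨-, ⟨h1, h2⟩ | ⟨t, ht, h1, h2⟩⟩
          · exact absurd h hqy
          · left
            rw [mul_add, hone]
            push_cast at h2 ⊢
            omega
          · refine Or.inr ⟨t, ht, ?_⟩
            rw [add_sub_assoc, mul_add, hone]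
            push_cast at h2 ⊢
            omega
        · rw [leadExp_eq_zero (hq.leadExp_ne_zero hlt hqy) hσx, add_zero, hone]
          left; omega

/-- If one basis element is sent to `a ^ m * b ^ m` and the other ones injectively to basis
elements, then no nontrivial reduced word of length less than `m` becomes trivial. -/
theorem lift_ne_one [DecidableEq κ] (hσ : Set.InjOn σ {y}ᶜ) (hab : a ≠ b)
    {φ : κ → FreeGroup ι} (hy : φ y = of a ^ m * of b ^ m) (hφ : ∀ x ≠ y, φ x = of (σ x))
    {w : FreeGroup κ} (hw : w ≠ 1) (hm : w.norm < m) : lift φ w ≠ 1 := by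
  rw [norm] at hm
  have hred : IsReduced w.toWord := isReduced_toWord
  rw [← mk_toWord (x := w)]
  rcases h : w.toWord with _ | ⟨p, L⟩
  · exact absurd (toWord_eq_nil_iff.1 h) hw
  · rw [h] at hm hred
    exact (leadsWith_lift hσ hab hy hφ hred hm).ne_one hm

theorem norm_lift_le [DecidableEq κ] {φ : κ → FreeGroup ι} {C : ℕ} (hφ : ∀ x, (φ x).norm ≤ C)
    (w : FreeGroup κ) : (lift φ w).norm ≤ C * w.norm := by
  have key : ∀ L : List (κ × Bool), (lift φ (mk L)).norm ≤ C * L.length := by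
    intro L
    induction L with
    | nil => rw [← one_eq_mk, _root_.map_one, norm_one]; exact Nat.zero_le _
    | cons p L ih =>
      rw [lift_mk_cons, List.length_cons, mul_add, mul_one, add_comm]
      refine (norm_mul_le _ _).trans (add_le_add ?_ ih)
      rcases p with ⟨x, _ | _⟩
      · simpa using hφ x
      · simpa using hφ x
  have h := key w.toWord
  rwa [mk_toWord] at h

end FreeGroup

/-! ## Elements of `F` moving a point off a given finite set of `x₀`-orbits -/

/-- Iterates the copies into halves; these are available for every element since `x0` and `x1`
generate `F`. -/
theorem exists_copy_on_leaf (f : ThompsonF) {n : ℕ} {l : unitInterval → unitInterval}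
    (hl : l ∈ (DyadicTree.complete n).leaves) :
    ∃ h : ThompsonF, (∀ x, h (l x) = l (f x)) ∧ ∀ x, x ∉ Set.range l → h x = x := by
  have hmem : ∀ h : ThompsonF, h ∈ stdSubgroup := fun h => by
    rw [stdSubgroup_eq_top]; exact Subgroup.mem_top h
  induction n generalizing l with
  | zero =>
    simp only [DyadicTree.complete, DyadicTree.leaves, List.mem_singleton] at hl
    subst hl
    exact ⟨f, fun _ => rfl, fun x hx => absurd ⟨x, rfl⟩ hx⟩
  | succ n ih =>
    simp only [DyadicTree.complete, DyadicTree.leaves, List.mem_append, List.mem_map] at hl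
    rcases hl with ⟨l, hl, rfl⟩ | ⟨l, hl, rfl⟩
    · obtain ⟨h, h1, h2⟩ := ih hl
      obtain ⟨k, -, k1, k2⟩ := exists_isLeftCopy (hmem h)
      refine ⟨k, fun x => by simp [k2, h1], fun x hx => ?_⟩
      rcases half_cases x with ⟨y, rfl⟩ | ⟨y, rfl⟩
      · rw [k2, h2]
        rintro ⟨z, rfl⟩
        exact hx ⟨z, rfl⟩
      · exact k1 y
    · obtain ⟨h, h1, h2⟩ := ih hl
      obtain ⟨k, -, k1, k2⟩ := exists_isRightCopy (hmem h)
      refine ⟨k, fun x => by simp [k2, h1], fun x hx => ?_⟩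
      rcases half_cases x with ⟨y, rfl⟩ | ⟨y, rfl⟩
      · exact k1 y
      · rw [k2, h2]
        rintro ⟨z, rfl⟩
        exact hx ⟨z, rfl⟩

/-! ### Non-dyadic points and orbits under multiplication by `2` -/

theorem not_isDyadic_apply (f : ThompsonF) {x : unitInterval} (hx : ¬ IsDyadic (x : ℝ)) :
    ¬ IsDyadic (f x : ℝ) := by
  intro h
  have := (f⁻¹).2.2.map_dyadic (f⁻¹).2.1 _ h
  exact hx (by rwa [show (f⁻¹).1 (f x) = x from ThompsonF.inv_apply_self f x] at this)

theorem pos_of_not_isDyadic {x : unitInterval} (hx : ¬ IsDyadic (x : ℝ)) : 0 < (x : ℝ) := by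
  refine lt_of_le_of_ne x.2.1 fun h => hx ?_
  rw [← h]
  exact ⟨0, 0, by simp⟩

theorem lt_one_of_not_isDyadic {x : unitInterval} (hx : ¬ IsDyadic (x : ℝ)) : (x : ℝ) < 1 := by
  refine lt_of_le_of_ne x.2.2 fun h => hx ?_
  rw [h]
  exact ⟨1, 0, by simp⟩

theorem x0Fun_lt {x : ℝ} (h0 : 0 < x) (h1 : x < 1) : x0Fun x < x := by
  unfold x0Fun
  split_ifs <;> linarith

theorem x0_pow_apply_injective {z : unitInterval} (hz : ¬ IsDyadic (z : ℝ)) :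
    Function.Injective fun n : ℕ => (x0 ^ n) z := by
  have hanti : StrictAnti fun n : ℕ => (((x0 ^ n) z : unitInterval) : ℝ) := by
    refine strictAnti_nat_of_succ_lt fun n => ?_
    have h := not_isDyadic_apply (x0 ^ n) hz
    have h1 : (x0 ^ (n + 1)) z = x0 ((x0 ^ n) z) := by rw [pow_succ']; rfl
    rw [h1, coe_x0]
    exact x0Fun_lt (pos_of_not_isDyadic h) (lt_one_of_not_isDyadic h)
  intro n n' h
  exact hanti.injective (congrArg Subtype.val h)

/-- Distinct positive points of one orbit under doubling differ by at least the smaller of them. -/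
theorem eq_of_zpow_mul_of_abs_sub_lt {y s t : ℝ} {d e : ℤ} (hs : s = 2 ^ d * y)
    (ht : t = 2 ^ e * y) {r : ℝ} (hr : |s - t| ≤ r) (hsr : r < s) (htr : r < t) : s = t := by
  have aux : ∀ {s t : ℝ} {d e : ℤ}, s = 2 ^ d * y → t = 2 ^ e * y → |s - t| ≤ r → r < s →
      r < t → ¬ d < e := by
    intro s t d e hs ht hr hsr htr hde
    obtain ⟨j, rfl⟩ : ∃ j : ℕ, e = d + 1 + j := ⟨(e - d - 1).toNat, by omega⟩
    have hpos : 0 < s := (abs_nonneg _).trans_lt (hr.trans_lt hsr)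
    have h2 : t = 2 * 2 ^ j * s := by
      rw [ht, hs, zpow_add₀ two_ne_zero, zpow_add₀ two_ne_zero, zpow_one, zpow_natCast]
      ring
    have h1 : (1 : ℝ) ≤ 2 ^ j := one_le_pow₀ (by norm_num)
    have h3 := (abs_le.1 hr).1
    nlinarith
  have h1 := aux hs ht hr hsr htr
  have h2 := aux ht hs (by rwa [abs_sub_comm]) htr hsr
  obtain rfl : d = e := by omega
  rw [hs, ht]

/-- On a short standard dyadic interval around `p`, the powers of a rescaled `x0` move `p` to
infinitely many points. The interval is shorter than its distance from `0`, so it meets each of the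
finitely many orbits to be avoided at most once. -/
theorem exists_bump {p : unitInterval} (hp : ¬ IsDyadic (p : ℝ)) {δ : ℝ} (hδ : 0 < δ)
    (S : Finset ℝ) :
    ∃ g : ThompsonF, (∀ x : unitInterval, δ ≤ |(x : ℝ) - p| → g x = x) ∧
      ∀ y ∈ S, ∀ n : ℤ, (g p : ℝ) ≠ 2 ^ n * y := by
  have hp0 := pos_of_not_isDyadic hp
  obtain ⟨N, hN⟩ := exists_pow_lt_of_lt_one (lt_min hδ (half_pos hp0))
    (by norm_num : (1 / 2 : ℝ) < 1)
  rw [lt_min_iff, one_div_pow] at hN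
  obtain ⟨l, hl, z, rfl⟩ := (DyadicTree.complete N).exists_leaf p
  obtain ⟨h, h1, h2⟩ := exists_copy_on_leaf x0 hl
  obtain ⟨c, hc⟩ := DyadicTree.isStandard_of_mem_leaves_complete hl
  have hpow : (0 : ℝ) < 2 ^ N := by positivity
  have hdist : ∀ s t : unitInterval, |(l s : ℝ) - l t| ≤ 1 / 2 ^ N := by
    intro s t
    rw [hc, hc, ← sub_div, abs_div, abs_of_pos hpow]
    gcongr
    rw [abs_le]
    have := s.2.1; have := s.2.2; have := t.2.1; have := t.2.2
    constructor <;> linarith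
  have hz : ¬ IsDyadic (z : ℝ) := by
    rintro ⟨a, n, h⟩
    refine hp ⟨c * 2 ^ n + a, n + N, ?_⟩
    rw [hc, h]
    push_cast
    rw [pow_add]
    field_simp
  have hn : ∀ n : ℕ, ∀ x, (h ^ n) (l x) = l ((x0 ^ n) x) := by
    intro n
    induction n with
    | zero => intro x; rfl
    | succ n ih =>
      intro x
      rw [pow_succ', pow_succ', ThompsonF.mul_apply, ih, h1, ThompsonF.mul_apply]
  have hfix : ∀ n : ℕ, ∀ x : unitInterval, δ ≤ |(x : ℝ) - l z| → (h ^ n) x = x := by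
    intro n x hx
    have hxl : x ∉ Set.range l := by
      rintro ⟨y, rfl⟩
      linarith [hdist y z]
    induction n with
    | zero => rfl
    | succ n ih => rw [pow_succ', ThompsonF.mul_apply, ih, h2 x hxl]
  by_contra hcon
  push Not at hcon
  choose y hy e he using fun n : ℕ => hcon (h ^ n) (hfix n)
  -- Pigeonhole: if every power of `h` failed, two of them would send `p` into the orbit of the same
  -- element of `S`.
  obtain ⟨n, n', hne, heq⟩ := Finite.exists_ne_map_eq_of_infinite
    fun n : ℕ => (⟨y n, hy n⟩ : S)
  have hyy : y n = y n' := congrArg Subtype.val heq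
  refine hne (x0_pow_apply_injective hz ?_)
  have e1 := he n
  have e2 := he n'
  rw [← hyy] at e2
  rw [hn] at e1 e2
  have hlow : ∀ s, 1 / 2 ^ N < (l s : ℝ) := fun s => by
    have := (abs_le.1 (hdist s z)).1
    linarith
  have h3 := eq_of_zpow_mul_of_abs_sub_lt e1 e2 (hdist _ _) (hlow _) (hlow _)
  rw [hc, hc, div_left_inj' hpow.ne', add_right_inj] at h3
  exact Subtype.ext h3

theorem exists_pos_le_abs_sub (Y : Finset ℝ) (r : ℝ) :
    ∃ δ : ℝ, 0 < δ ∧ ∀ y ∈ Y, y ≠ r → δ ≤ |y - r| := by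
  induction Y using Finset.induction_on with
  | empty => exact ⟨1, one_pos, by simp⟩
  | insert a Y _ ih =>
    obtain ⟨δ, hδ, h⟩ := ih
    by_cases ha : a = r
    · refine ⟨δ, hδ, fun y hy hyr => ?_⟩
      rcases Finset.mem_insert.1 hy with rfl | hy
      · exact absurd ha hyr
      · exact h y hy hyr
    · refine ⟨min δ |a - r|, lt_min hδ (abs_pos.2 (sub_ne_zero.2 ha)), fun y hy hyr => ?_⟩
      rcases Finset.mem_insert.1 hy with rfl | hy
      · exact min_le_right _ _
      · exact (min_le_left _ _).trans (h y hy hyr)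

theorem exists_not_isDyadic {r : ℝ} (h0 : 0 < r) (h1 : r ≤ 1) :
    ∃ p : unitInterval, ¬ IsDyadic (p : ℝ) ∧ (p : ℝ) < r := by
  obtain ⟨x, hx, hx0, hxr⟩ := exists_irrational_btwn h0
  refine ⟨⟨x, hx0.le, hxr.le.trans h1⟩, ?_, hxr⟩
  rintro ⟨a, n, h⟩
  refine hx ⟨a / 2 ^ n, ?_⟩
  push_cast
  exact h.symm

/-! ## A generic trajectory -/

open FreeGroup in
/-- The image of `p` under the word `L` in `x₀` and the `u i`. -/
noncomputable def trajectory {k : ℕ} (u : Fin (k + 1) → ThompsonF) (p : unitInterval)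
    (L : List (Fin (k + 2) × Bool)) : unitInterval :=
  (lift (Fin.cons x0 u : Fin (k + 2) → ThompsonF) (mk L)) p

section Trajectory

variable {k : ℕ} {u : Fin (k + 1) → ThompsonF} {p : unitInterval}

theorem trajectory_nil : trajectory u p [] = p := by
  rw [trajectory, ← FreeGroup.one_eq_mk, map_one]
  rfl

theorem trajectory_cons (a : Fin (k + 2) × Bool) (L : List (Fin (k + 2) × Bool)) :
    trajectory u p (a :: L) = (cond a.2 ((Fin.cons x0 u : Fin (k + 2) → ThompsonF) a.1)
      ((Fin.cons x0 u : Fin (k + 2) → ThompsonF) a.1)⁻¹) (trajectory u p L) := by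
  rw [trajectory, FreeGroup.lift_mk_cons]
  rfl

theorem not_isDyadic_trajectory (hp : ¬ IsDyadic (p : ℝ)) (L : List (Fin (k + 2) × Bool)) :
    ¬ IsDyadic (trajectory u p L : ℝ) := not_isDyadic_apply _ hp

/-- All `u i` are the identity on `[η, 1]` and fix the points `η / 2 ^ j` with `j ≤ M`. -/
def FixesScales (η : ℝ) (M : ℕ) (u : Fin (k + 1) → ThompsonF) : Prop :=
  ∀ i, ∀ x : unitInterval, (η ≤ x ∨ ∃ j ≤ M, (x : ℝ) = η / 2 ^ j) → u i x = x

/-- The points of the trajectory are in distinct orbits of multiplication by `2`, except where the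
word prescribes otherwise. -/
def IsGeneric (u : Fin (k + 1) → ThompsonF) (p : unitInterval)
    (L : List (Fin (k + 2) × Bool)) : Prop :=
  ∀ L₁ L₂, L₁ <:+ L → L₂ <:+ L₁ → L₂ ≠ L₁ → ∀ n : ℤ,
    (trajectory u p L₂ : ℝ) = 2 ^ n * trajectory u p L₁ →
      ∃ e, L₁.head? = some (0, e) ∧ 0 < FreeGroup.expSign e * n

/-- A coincidence would be the case `n = 0`, which the strict sign condition excludes. -/
theorem IsGeneric.injOn {L : List (Fin (k + 2) × Bool)} (h : IsGeneric u p L)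
    {T T' : List (Fin (k + 2) × Bool)} (hT : T <:+ L) (hT' : T' <:+ L)
    (heq : trajectory u p T = trajectory u p T') : T = T' := by
  have aux : ∀ {T T' : List (Fin (k + 2) × Bool)}, T <:+ L → T' <:+ T →
      trajectory u p T = trajectory u p T' → T' = T := by
    intro T T' hT hTT' heq
    by_contra hne
    obtain ⟨e, -, he⟩ := h T T' hT hTT' hne 0 (by rw [heq]; simp)
    simp at he
  rcases List.suffix_or_suffix_of_suffix hT hT' with h1 | h1
  · exact aux hT' h1 heq.symm
  · exact (aux hT h1 heq).symm

theorem coe_x0_of_le {x : unitInterval} (h : (x : ℝ) ≤ 1 / 2) : (x0 x : ℝ) = x / 2 := by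
  rw [coe_x0, x0Fun, if_pos h]

theorem coe_x0_inv_of_le {x : unitInterval} (h : (x : ℝ) ≤ 1 / 4) :
    ((x0⁻¹ : ThompsonF) x : ℝ) = 2 * x := by
  have h0 := x.2.1
  have h2 : x0⁻¹ x = (⟨2 * x, by constructor <;> linarith⟩ : unitInterval) := by
    refine ThompsonF.inv_apply_eq (Subtype.ext ?_)
    rw [coe_x0_of_le (by simp only; linarith)]
    simp
  rw [h2]

/-- Near `0` the letter `x0` only halves, so the new point stays in the orbit of the last one. An
earlier point of that orbit belongs to the same run of `x0`-letters; reducedness gives this run a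
constant sign, so the exponents accumulate and never return to `0`. -/
theorem IsGeneric.cons_zero {L : List (Fin (k + 2) × Bool)} (h : IsGeneric u p L)
    (hp : ¬ IsDyadic (p : ℝ)) {e : Bool} (hred : FreeGroup.IsReduced ((0, e) :: L))
    (hx : (trajectory u p ((0, e) :: L) : ℝ) =
      2 ^ (-FreeGroup.expSign e) * trajectory u p L) : IsGeneric u p ((0, e) :: L) := by
  intro L₁ L₂ h1 h2 hne n hn
  rcases List.suffix_cons_iff.1 h1 with rfl | h1
  · refine ⟨e, rfl, ?_⟩
    have h2' : L₂ <:+ L := (List.suffix_cons_iff.1 h2).resolve_left hne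
    rw [hx, ← mul_assoc, ← zpow_add₀ two_ne_zero] at hn
    have hone : FreeGroup.expSign e * FreeGroup.expSign e = 1 := by cases e <;> rfl
    by_cases hL : L₂ = L
    · subst hL
      have hpos := pos_of_not_isDyadic (not_isDyadic_trajectory (u := u) hp L₂)
      have h3 : (2 : ℝ) ^ (n + -FreeGroup.expSign e) = 1 :=
        mul_right_cancel₀ hpos.ne' (by rw [← hn, one_mul])
      rw [zpow_eq_one_iff_right₀ (by norm_num) (by norm_num)] at h3
      obtain rfl : n = FreeGroup.expSign e := by omega
      omega
    · obtain ⟨e', he', hpos⟩ := h L L₂ (List.suffix_refl L) h2' hL _ hn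
      obtain ⟨T, rfl⟩ : ∃ T, L = (0, e') :: T := by
        cases L with
        | nil => simp at he'
        | cons a T => exact ⟨T, by simpa using he'⟩
      obtain rfl : e = e' := (FreeGroup.isReduced_cons_cons.1 hred).1 rfl
      rw [mul_add, mul_neg, hone] at hpos
      omega
  · exact h L₁ L₂ h1 h2 hne n hn

theorem lt_of_fixes {f : ThompsonF} {x : unitInterval} {r : ℝ} (hr : r ∈ unitInterval)
    (hf : f ⟨r, hr⟩ = ⟨r, hr⟩) (hx : (x : ℝ) < r) : (f x : ℝ) < r := by
  have h : f x < f ⟨r, hr⟩ := ThompsonF.strictMono f hx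
  rwa [hf] at h

theorem inv_apply_eq_self {f : ThompsonF} {x : unitInterval} (h : f x = x) : f⁻¹ x = x :=
  ThompsonF.inv_apply_eq h

theorem cond_apply_eq_self {f : ThompsonF} {x : unitInterval} (h : f x = x) (e : Bool) :
    (cond e f f⁻¹) x = x := by
  cases e
  · exact inv_apply_eq_self h
  · exact h

/-- Composing one generator with a bump that fixes the points of the trajectory other than the new
one leaves the trajectory unchanged. -/
theorem trajectory_update {L : List (Fin (k + 2) × Bool)} (h : IsGeneric u p L)
    {i : Fin (k + 1)} {e : Bool} (hred : FreeGroup.IsReduced ((i.succ, e) :: L)) {g : ThompsonF}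
    (hg : ∀ T, T <:+ L → trajectory u p T ≠ (cond e (u i) (u i)⁻¹) (trajectory u p L) →
      g (trajectory u p T) = trajectory u p T)
    {u' : Fin (k + 1) → ThompsonF} (hu' : ∀ j ≠ i, u' j = u j)
    (hu'i : cond e (u' i) (u' i)⁻¹ = g * cond e (u i) (u i)⁻¹)
    {T : List (Fin (k + 2) × Bool)} (hT : T <:+ L) : trajectory u' p T = trajectory u p T := by
  induction T with
  | nil => rw [trajectory_nil, trajectory_nil]
  | cons a T ih =>
    have hT' : T <:+ L := (List.suffix_cons a T).trans hT
    rw [trajectory_cons, trajectory_cons, ih hT']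
    have hTeq := trajectory_cons (u := u) (p := p) a T
    rcases a with ⟨x, b⟩
    refine Fin.cases (fun _ _ => rfl) (fun j hT hTeq => ?_) x hT hTeq
    simp only [Fin.cons_succ] at hTeq ⊢
    by_cases hj : j = i
    · subst hj
      by_cases hb : b = e
      · subst hb
        rw [hu'i, ThompsonF.mul_apply, ← hTeq, hg _ hT]
        rw [hTeq]
        intro h0
        -- Equal images under the same letter would identify the points at `T` and at `L`, but `T`
        -- is a proper suffix.
        have := h.injOn hT' (List.suffix_refl L) (ThompsonF.injective _ h0)
        subst this
        have := hT.length_le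
        simp at this
      · have hinv : cond b (u' j) (u' j)⁻¹ = cond b (u j) (u j)⁻¹ * g⁻¹ := by
          have h1 : ∀ f : ThompsonF, cond b f f⁻¹ = (cond e f f⁻¹)⁻¹ := by
            intro f
            cases b <;> cases e <;> simp at hb ⊢
          rw [h1, h1, hu'i, mul_inv_rev]
        rw [hinv, ThompsonF.mul_apply, inv_apply_eq_self (hg T hT' _)]
        -- If the point at `T` were the new point, the letter `b = !e` would lead it back to the
        -- point at `L`. Then `L` itself would begin with the inverse of the new letter, against
        -- reducedness.
        intro h0
        have h1 : trajectory u p ((j.succ, b) :: T) = trajectory u p L := by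
          rw [hTeq, h0]
          cases b <;> cases e <;> simp at hb ⊢
        have := h.injOn hT (List.suffix_refl L) h1
        subst this
        exact hb ((FreeGroup.isReduced_cons_cons.1 hred).1 rfl).symm
    · rw [hu' j hj]

/-- Induction along the word. A letter `x0` cannot be adjusted, which is why orbits under doubling,
and not just points, are kept apart. For a letter `u i` the generator is composed with a bump that
moves only the new point off all earlier orbits. Since the `u i` fix the scales `1 / 2 ^ N / 2 ^ j`,
only `x0⁻¹` can carry a point to the next scale, so starting below `1 / 2 ^ N / 2 ^ M` leaves room
for `M` letters within the region where `x0` and its inverse are linear. -/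
theorem exists_isGeneric {N : ℕ} (hN : 2 ≤ N) (M : ℕ) {L : List (Fin (k + 2) × Bool)}
    (hL : FreeGroup.IsReduced L) (hM : L.length ≤ M) :
    ∃ (u : Fin (k + 1) → ThompsonF) (p : unitInterval), FixesScales (1 / 2 ^ N) M u ∧
      ¬ IsDyadic (p : ℝ) ∧ IsGeneric u p L ∧
      ∀ T, T <:+ L → (trajectory u p T : ℝ) < 1 / 2 ^ N / 2 ^ (M - T.length) := by
  have hη : (1 : ℝ) / 2 ^ N ≤ 1 / 4 := by
    have : (2 : ℝ) ^ 2 ≤ 2 ^ N := pow_le_pow_right₀ (by norm_num) hN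
    exact one_div_le_one_div_of_le (by norm_num) (by linarith)
  have hη0 : (0 : ℝ) < 1 / 2 ^ N := by positivity
  have hscale : ∀ j : ℕ, (1 : ℝ) / 2 ^ N / 2 ^ j ∈ unitInterval := fun j =>
    ⟨by positivity, (div_le_self hη0.le (one_le_pow₀ (by norm_num))).trans (by linarith)⟩
  have hscale' : ∀ j : ℕ, IsDyadic ((1 : ℝ) / 2 ^ N / 2 ^ j) := fun j =>
    ⟨1, N + j, by rw [pow_add, div_div]; norm_num⟩
  induction L with
  | nil =>
    obtain ⟨p, hp, hpM⟩ := exists_not_isDyadic (r := 1 / 2 ^ N / 2 ^ M) (by positivity)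
      (hscale M).2
    refine ⟨fun _ => 1, p, fun _ _ _ => rfl, hp, ?_, ?_⟩
    · intro L₁ L₂ h1 h2 hne
      rw [List.suffix_nil] at h1
      subst h1
      rw [List.suffix_nil] at h2
      exact absurd h2 hne
    · intro T hT
      rw [List.suffix_nil] at hT
      subst hT
      rwa [trajectory_nil]
  | cons a L ih =>
    simp only [List.length_cons] at hM
    obtain ⟨u, p, hu, hp, hgen, hbound⟩ := ih (hL.infix (List.suffix_cons a L).isInfix) (by omega)
    have hq := hbound L (List.suffix_refl L)
    obtain ⟨d, hd⟩ : ∃ d, M - L.length = d + 1 := ⟨M - L.length - 1, by omega⟩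
    have hd' : M - (a :: L).length = d := by simp only [List.length_cons]; omega
    rw [hd] at hq
    have hle : (1 : ℝ) / 2 ^ N / 2 ^ (d + 1) ≤ 1 / 2 ^ N / 2 ^ d :=
      div_le_div_of_nonneg_left hη0.le (by positivity)
        (pow_le_pow_right₀ (by norm_num) (Nat.le_succ d))
    have hsucc : (1 : ℝ) / 2 ^ N / 2 ^ d = 2 * (1 / 2 ^ N / 2 ^ (d + 1)) := by
      rw [pow_succ]; field_simp
    have hpos := pos_of_not_isDyadic (not_isDyadic_trajectory (u := u) hp L)
    have hd1 : (1 : ℝ) / 2 ^ N / 2 ^ d ≤ 1 / 2 ^ N :=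
      div_le_self hη0.le (one_le_pow₀ (by norm_num))
    rcases a with ⟨x, e⟩
    refine Fin.cases (fun hL hd' => ?_) (fun i hL hd' => ?_) x hL hd'
    · have hx : (trajectory u p ((0, e) :: L) : ℝ) =
          2 ^ (-FreeGroup.expSign e) * trajectory u p L := by
        rw [trajectory_cons]
        cases e
        · simp only [cond, Fin.cons_zero, FreeGroup.expSign, neg_neg, zpow_one]
          exact coe_x0_inv_of_le (by linarith)
        · simp only [cond, Fin.cons_zero, FreeGroup.expSign, zpow_neg_one]
          rw [coe_x0_of_le (by linarith)]
          ring
      refine ⟨u, p, hu, hp, hgen.cons_zero hp hL hx, fun T hT => ?_⟩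
      rcases List.suffix_cons_iff.1 hT with rfl | hT
      · rw [hd', hx]
        cases e
        · simp only [FreeGroup.expSign, cond, neg_neg, zpow_one]
          linarith
        · simp only [FreeGroup.expSign, cond, zpow_neg_one]
          linarith
      · exact hbound T hT
    · classical
      have hr := not_isDyadic_apply (cond e (u i) (u i)⁻¹)
        (not_isDyadic_trajectory (u := u) hp L)
      have hrlt : ((cond e (u i) (u i)⁻¹) (trajectory u p L) : ℝ) < 1 / 2 ^ N / 2 ^ (d + 1) :=
        lt_of_fixes (hscale _)
          (cond_apply_eq_self (hu i _ (Or.inr ⟨d + 1, by omega, rfl⟩)) e) hq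
      obtain ⟨r, hrdef⟩ : ∃ r, r = (cond e (u i) (u i)⁻¹) (trajectory u p L) := ⟨_, rfl⟩
      rw [← hrdef] at hr hrlt
      let S : Finset ℝ := (L.tails.map fun T => (trajectory u p T : ℝ)).toFinset
      have hS : ∀ T, T <:+ L → (trajectory u p T : ℝ) ∈ S := fun T hT => by
        simp only [S, List.mem_toFinset, List.mem_map, List.mem_tails]
        exact ⟨T, hT, rfl⟩
      let Y : Finset ℝ := (Finset.range (M + 1)).image fun j => (1 : ℝ) / 2 ^ N / 2 ^ j
      have hY : ∀ j ≤ M, (1 : ℝ) / 2 ^ N / 2 ^ j ∈ Y := fun j hj =>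
        Finset.mem_image.2 ⟨j, Finset.mem_range.2 (by omega), rfl⟩
      -- The bump around `r` must fix all earlier points other than `r`, and all scales; `r` is not
      -- a scale because it is not dyadic.
      obtain ⟨δ, hδ, hδ'⟩ := exists_pos_le_abs_sub (S ∪ Y) r
      obtain ⟨g, hg, hgS⟩ := exists_bump hr hδ S
      have hne : ∀ j : ℕ, (1 : ℝ) / 2 ^ N / 2 ^ j ≠ r := fun j h => hr (h ▸ hscale' j)
      have hgT : ∀ T, T <:+ L → trajectory u p T ≠ r → g (trajectory u p T) = trajectory u p T :=
        fun T hT hTr => hg _ (hδ' _ (Finset.mem_union_left _ (hS T hT))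
          fun h => hTr (Subtype.ext h))
      have hgfix : ∀ x : unitInterval,
          ((1 : ℝ) / 2 ^ N ≤ x ∨ ∃ j ≤ M, (x : ℝ) = 1 / 2 ^ N / 2 ^ j) → g x = x := by
        rintro x (hx | ⟨j, hj, hx⟩)
        · refine hg x ?_
          have h1 := hδ' _ (Finset.mem_union_right _ (hY 0 (Nat.zero_le _))) (hne 0)
          rw [pow_zero, div_one, abs_of_pos (by linarith)] at h1
          rw [abs_of_pos (by linarith)]
          linarith
        · refine hg x ?_
          rw [hx]
          exact hδ' _ (Finset.mem_union_right _ (hY j hj)) (hne j)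
      -- The modification makes the letter `u i` with sign `e` become `g` after the old letter, for
      -- either sign.
      let u' : Fin (k + 1) → ThompsonF :=
        Function.update u i (cond e (g * u i) (u i * g⁻¹))
      have hu'i : cond e (u' i) (u' i)⁻¹ = g * cond e (u i) (u i)⁻¹ := by
        cases e <;> simp [u']
      have hu'j : ∀ j ≠ i, u' j = u j := fun j hj => Function.update_of_ne hj _ _
      have htraj : ∀ T, T <:+ L → trajectory u' p T = trajectory u p T := fun T hT =>
        trajectory_update hgen hL (by rw [← hrdef]; exact hgT) hu'j hu'i hT
      have hnew : trajectory u' p ((i.succ, e) :: L) = g r := by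
        rw [trajectory_cons, htraj L (List.suffix_refl L)]
        simp only [Fin.cons_succ]
        rw [hu'i, ThompsonF.mul_apply, hrdef]
      refine ⟨u', p, fun j x hx => ?_, hp, fun L₁ L₂ h1 h2 hne n hn => ?_, fun T hT => ?_⟩
      · by_cases hj : j = i
        · subst hj
          have h1 := hgfix x hx
          have h2 := hu j x hx
          simp only [u', Function.update_self]
          cases e
          · rw [cond, ThompsonF.mul_apply, inv_apply_eq_self h1, h2]
          · rw [cond, ThompsonF.mul_apply, h2, h1]
        · rw [hu'j j hj]
          exact hu j x hx
      · rcases List.suffix_cons_iff.1 h1 with rfl | h1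
        · have h2' : L₂ <:+ L := (List.suffix_cons_iff.1 h2).resolve_left hne
          rw [htraj L₂ h2', hnew] at hn
          refine absurd ?_ (hgS _ (hS L₂ h2') (-n))
          rw [hn, ← mul_assoc, ← zpow_add₀ two_ne_zero]
          simp
        · rw [htraj _ h1, htraj _ (h2.trans h1)] at hn
          exact hgen L₁ L₂ h1 h2 hne n hn
      · rcases List.suffix_cons_iff.1 hT with rfl | hT
        · rw [hd', hnew]
          refine (lt_of_fixes (hscale (d + 1)) (hgfix _ (Or.inr ⟨d + 1, by omega, rfl⟩))
            hrlt).trans_le hle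
        · rw [htraj T hT]
          exact hbound T hT

end Trajectory

/-! ## Existence of admissible tuples -/

/-- A separating letter without cancellation on either side; two distinct basis elements suffice,
since a letter different from both neighbours or of matching sign can be chosen. -/
theorem exists_letter {k : ℕ} (s t : Option (Fin (k + 2) × Bool)) :
    ∃ c : Fin (k + 2) × Bool, (∀ x ∈ s, x.1 = c.1 → x.2 = c.2) ∧
      ∀ y ∈ t, c.1 = y.1 → c.2 = y.2 := by
  have aux : ∀ x y : Fin (k + 2) × Bool, ∃ c : Fin (k + 2) × Bool,
      (x.1 = c.1 → x.2 = c.2) ∧ (c.1 = y.1 → c.2 = y.2) := by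
    rintro ⟨x, b⟩ ⟨y, b'⟩
    by_cases hx : x = 0
    · by_cases hy : y = 0
      · refine ⟨(1, true), fun h => ?_, fun h => ?_⟩
        · exact absurd (hx.symm.trans h) (by simp)
        · exact absurd (hy.symm.trans h.symm) (by simp)
      · exact ⟨(0, b), fun _ => rfl, fun h => absurd h.symm hy⟩
    · exact ⟨(0, b'), fun h => absurd h hx, fun _ => rfl⟩
  cases s with
  | none =>
    cases t with
    | none => exact ⟨(0, true), by simp, by simp⟩
    | some y => exact ⟨y, by simp, by simp⟩
  | some x =>
    cases t with
    | none => exact ⟨x, by simp, by simp⟩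
    | some y =>
      obtain ⟨c, h1, h2⟩ := aux x y
      exact ⟨c, by simpa using h1, by simpa using h2⟩

theorem exists_isReduced_forall_isInfix {k : ℕ} (W : List (List (Fin (k + 2) × Bool)))
    (hW : ∀ w ∈ W, FreeGroup.IsReduced w) :
    ∃ V, FreeGroup.IsReduced V ∧ ∀ w ∈ W, w <:+: V := by
  induction W with
  | nil => exact ⟨[], FreeGroup.IsReduced.nil, by simp⟩
  | cons w W ih =>
    obtain ⟨V, hV, h⟩ := ih fun w' hw' => hW w' (by simp [hw'])
    obtain ⟨c, h1, h2⟩ := exists_letter w.getLast? V.head?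
    refine ⟨w ++ [c] ++ V, ?_, ?_⟩
    · refine FreeGroup.IsReduced.append_overlap ?_ ?_ (by simp)
      · refine List.isChain_append.2 ⟨hW w (by simp), FreeGroup.IsReduced.singleton, ?_⟩
        intro x hx y hy
        simp only [List.head?_cons, Option.mem_def, Option.some.injEq] at hy
        subst hy
        exact h1 x hx
      · refine List.isChain_append.2 ⟨FreeGroup.IsReduced.singleton, hV, ?_⟩
        intro x hx y hy
        simp only [List.getLast?_singleton, Option.mem_def, Option.some.injEq] at hx
        subst hx
        exact h2 y hy
    · intro w' hw'
      rcases List.mem_cons.1 hw' with rfl | hw'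
      · exact ⟨[], [c] ++ V, by simp⟩
      · exact (h w' hw').trans ⟨w ++ [c], [], by simp⟩

/-- If `w` is followed by `B` in `V`, then `w` carries the point at `B` to the point at `w ++ B`,
which differs by genericity. One tuple thus serves all short words. -/
theorem exists_isAdmissible (k m : ℕ) {ε : ℝ} (hε : 0 < ε) :
    ∃ u : Fin (k + 1) → ThompsonF, IsAdmissible m ε u := by
  obtain ⟨N, hN2, hN⟩ : ∃ N : ℕ, 2 ≤ N ∧ (1 : ℝ) / 2 ^ N < ε := by
    obtain ⟨N, hN⟩ := exists_pow_lt_of_lt_one hε (by norm_num : (1 / 2 : ℝ) < 1)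
    refine ⟨N + 2, by omega, lt_of_le_of_lt ?_ hN⟩
    rw [one_div_pow]
    exact one_div_le_one_div_of_le (by positivity)
      (pow_le_pow_right₀ (by norm_num) (by omega))
  have hfin : {w : List (Fin (k + 2) × Bool) | FreeGroup.IsReduced w ∧
      w.length ≤ 2 * m ^ 2}.Finite :=
    (List.finite_length_le (Fin (k + 2) × Bool) (2 * m ^ 2)).subset fun w hw => hw.2
  obtain ⟨V, hV, hVW⟩ := exists_isReduced_forall_isInfix hfin.toFinset.toList (by
    intro w hw
    simp only [Finset.mem_toList, Set.Finite.mem_toFinset, Set.mem_ofPred_eq] at hw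
    exact hw.1)
  obtain ⟨u, p, hu, hp, hgen, hbound⟩ := exists_isGeneric hN2 V.length hV le_rfl
  refine ⟨u, fun i x hx => ?_, fun w hw hwm => ?_⟩
  · have hsub : thompsonSupport (u i) ⊆ {x : unitInterval | (x : ℝ) ≤ 1 / 2 ^ N} := by
      refine closure_minimal (fun x hx => ?_)
        (isClosed_le continuous_subtype_val continuous_const)
      by_contra hlt
      exact hx (hu i x (Or.inl (not_le.1 hlt).le))
    exact (hsub hx).trans_lt hN
  · obtain ⟨A, B, hAB⟩ := hVW w.toWord (by
      simp only [Finset.mem_toList, Set.Finite.mem_toFinset, Set.mem_ofPred_eq]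
      exact ⟨FreeGroup.isReduced_toWord, hwm⟩)
    have hB : B <:+ V := ⟨A ++ w.toWord, by rw [hAB]⟩
    have hwB : w.toWord ++ B <:+ V := ⟨A, by rw [← hAB, List.append_assoc]⟩
    refine ⟨trajectory u p B, ?_, fun h => ?_⟩
    · refine (hbound B hB).trans (lt_of_le_of_lt ?_ hN)
      exact div_le_self (by positivity) (one_le_pow₀ (by norm_num))
    · have h1 : trajectory u p (w.toWord ++ B) = trajectory u p B := by
        conv_lhs => rw [trajectory, ← FreeGroup.mul_mk, FreeGroup.mk_toWord, map_mul]
        exact h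
      have h2 := hgen.injOn hwB hB h1
      have h3 : w.toWord = [] := by simpa using h2
      exact hw (FreeGroup.toWord_eq_nil_iff.1 h3)

/-! ## The marked groups -/

section Marking

variable {k : ℕ}

/-- The homomorphism of free groups that sends the second basis element to `a ^ m * b ^ m`, where
`a` and `b` are the first two basis elements of the target, and the other basis elements to those of
the target in order. -/
def collapse (k m : ℕ) : FreeGroup (Fin (k + 3)) →* FreeGroup (Fin (k + 2)) :=
  FreeGroup.lift (Fin.cons (FreeGroup.of 0)
    (Fin.cons (FreeGroup.of 0 ^ m * FreeGroup.of 1 ^ m) fun i : Fin (k + 1) =>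
      FreeGroup.of i.succ))

theorem collapse_ne_one {m : ℕ} {w : FreeGroup (Fin (k + 3))} (hw : w ≠ 1) (hm : w.norm < m) :
    collapse k m w ≠ 1 := by
  refine FreeGroup.lift_ne_one
    (σ := (Fin.cons 0 (Fin.cons 0 Fin.succ) : Fin (k + 3) → Fin (k + 2))) (y := 1) (a := 0)
    (b := 1) ?_ (by simp) rfl ?_ hw hm
  · intro x hx y hy
    refine Fin.cases (fun hx => ?_) (fun x => Fin.cases (fun hx => ?_) (fun x hx => ?_) x) x hx <;>
    refine Fin.cases (fun hy => ?_) (fun y => Fin.cases (fun hy => ?_) (fun y hy => ?_) y) y hy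
    · intro _; rfl
    · exact absurd rfl hy
    · intro h; exact absurd h.symm (Fin.succ_ne_zero _)
    · exact absurd rfl hx
    · exact absurd rfl hx
    · exact absurd rfl hx
    · intro h; exact absurd h (Fin.succ_ne_zero _)
    · exact absurd rfl hy
    · intro h
      have : x.succ = y.succ := h
      rw [this]
  · intro x hx
    refine Fin.cases (fun _ => rfl) (fun x => Fin.cases (fun h => absurd rfl h) (fun _ _ => rfl) x)
      x hx

theorem norm_collapse_le {m : ℕ} (hm : 1 ≤ m) (w : FreeGroup (Fin (k + 3))) :
    (collapse k m w).norm ≤ 2 * m * w.norm := by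
  refine FreeGroup.norm_lift_le (fun x => ?_) w
  refine Fin.cases ?_ (fun x => Fin.cases ?_ (fun x => ?_) x) x
  · rw [Fin.cons_zero, FreeGroup.norm_of]; omega
  · rw [Fin.cons_succ, Fin.cons_zero]
    refine (FreeGroup.norm_mul_le _ _).trans ?_
    rw [FreeGroup.norm_of_pow, FreeGroup.norm_of_pow]
    omega
  · rw [Fin.cons_succ, Fin.cons_succ, FreeGroup.norm_of]; omega

theorem closure_range_thompsonMarking (m : ℕ) (u : Fin (k + 1) → ThompsonF) :
    Subgroup.closure (Set.range (thompsonMarking m u)) = ⊤ := by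
  have hmem : ∀ j, thompsonMarking m u j ∈ Subgroup.closure (Set.range (thompsonMarking m u)) :=
    fun j => Subgroup.subset_closure ⟨j, rfl⟩
  have h0 : x0 ∈ Subgroup.closure (Set.range (thompsonMarking m u)) := hmem 0
  have h1 : x0 ^ m * u 0 ^ m * x1 ∈ Subgroup.closure (Set.range (thompsonMarking m u)) := hmem 1
  have h2 : u 0 ∈ Subgroup.closure (Set.range (thompsonMarking m u)) :=
    hmem (Fin.succ (Fin.succ 0))
  have h3 : x1 ∈ Subgroup.closure (Set.range (thompsonMarking m u)) :=
    (Subgroup.mul_mem_cancel_left _ (mul_mem (pow_mem h0 m) (pow_mem h2 m))).1 h1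
  rw [eq_top_iff, ← stdSubgroup_eq_top, stdSubgroup, Subgroup.closure_le]
  rintro x (rfl | rfl)
  exacts [h0, h3]

/-! ### The action of the marking near `0` -/

theorem coe_x0_le (x : unitInterval) : (x0 x : ℝ) ≤ x := by
  have h0 := x.2.1
  have h1 := x.2.2
  rw [coe_x0]
  unfold x0Fun
  split_ifs <;> linarith

theorem coe_le_two_mul_x0 (x : unitInterval) : (x : ℝ) ≤ 2 * x0 x := by
  have h0 := x.2.1
  rw [coe_x0]
  unfold x0Fun
  split_ifs <;> linarith

theorem coe_x0_pow_le (m : ℕ) (x : unitInterval) : ((x0 ^ m) x : ℝ) ≤ x := by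
  induction m with
  | zero => exact le_rfl
  | succ m ih => rw [pow_succ']; exact (coe_x0_le _).trans ih

theorem coe_x0_inv_pow_le (m : ℕ) (x : unitInterval) :
    (((x0 ^ m)⁻¹ : ThompsonF) x : ℝ) ≤ 2 ^ m * x := by
  induction m generalizing x with
  | zero => rw [pow_zero, pow_zero, one_mul, inv_one]; rfl
  | succ m ih =>
    rw [pow_succ', mul_inv_rev, ThompsonF.mul_apply]
    refine (ih _).trans ?_
    have h := coe_le_two_mul_x0 (x0⁻¹ x)
    rw [ThompsonF.apply_inv_self] at h
    rw [pow_succ, mul_assoc]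
    gcongr

theorem x1_apply_of_le {x : unitInterval} (h : (x : ℝ) ≤ 1 / 2) : x1 x = x :=
  Subtype.ext (by rw [coe_x1, x1Fun, if_pos h])

theorem apply_eq_self_of_thompsonSupport {f : ThompsonF} {ε : ℝ}
    (hf : ∀ x ∈ thompsonSupport f, (x : ℝ) < ε) {x : unitInterval} (hx : ε ≤ x) : f x = x := by
  by_contra h
  exact absurd (hf x (subset_closure h)) (not_lt.2 hx)

theorem apply_lt_of_fixes_ge {f : ThompsonF} {ε r : ℝ}
    (hf : ∀ x : unitInterval, ε ≤ x → f x = x) (hεr : ε ≤ r) {x : unitInterval}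
    (hx : (x : ℝ) < r) : (f x : ℝ) < r := by
  by_contra h
  push Not at h
  have h1 := ThompsonF.injective f (hf (f x) (hεr.trans h))
  rw [h1] at h
  exact absurd hx (not_lt.2 h)

/-- Near `0` the marking acts like the images of the basis elements under `collapse`. -/
theorem lift_thompsonMarking_apply {m : ℕ} (hm : 1 ≤ m) {ε : ℝ} (hε : 0 < ε)
    (hεm : 2 ^ (m ^ 2) * ε < 1 / 2) {u : Fin (k + 1) → ThompsonF}
    (hu : ∀ i, ∀ x : unitInterval, ε ≤ x → u i x = x) {x : unitInterval} (hx : (x : ℝ) < ε)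
    (L : List (Fin (k + 3) × Bool)) (hL : L.length ≤ m) :
    (FreeGroup.lift (thompsonMarking m u) (FreeGroup.mk L)) x =
      (FreeGroup.lift (Fin.cons x0 u : Fin (k + 2) → ThompsonF)
        (collapse k m (FreeGroup.mk L))) x ∧
    ((FreeGroup.lift (thompsonMarking m u) (FreeGroup.mk L)) x : ℝ) <
      2 ^ (L.length * m) * ε := by
  induction L with
  | nil =>
    rw [← FreeGroup.one_eq_mk, map_one, map_one, map_one]
    exact ⟨rfl, by simpa using hx⟩
  | cons a L ih =>
    simp only [List.length_cons] at hL ⊢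
    obtain ⟨h1, h2⟩ := ih (by omega)
    rw [FreeGroup.lift_mk_cons, collapse, FreeGroup.lift_mk_cons, map_mul, ThompsonF.mul_apply,
      ThompsonF.mul_apply, ← collapse, ← h1]
    generalize (FreeGroup.lift (thompsonMarking m u) (FreeGroup.mk L)) x = v at h2 ⊢
    have hpow : (2 : ℝ) ^ ((L.length + 1) * m) = 2 ^ m * 2 ^ (L.length * m) := by
      rw [← pow_add]; congr 1; ring
    have h2m : (2 : ℝ) ≤ 2 ^ m := by
      simpa using pow_le_pow_right₀ (by norm_num : (1 : ℝ) ≤ 2) hm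
    have hB : ε ≤ 2 ^ (L.length * m) * ε :=
      le_mul_of_one_le_left hε.le (one_le_pow₀ (by norm_num))
    have hB' : 2 ^ ((L.length + 1) * m) * ε = 2 ^ m * (2 ^ (L.length * m) * ε) := by
      rw [hpow, mul_assoc]
    -- This is where `L.length + 1 ≤ m` enters: the total expansion is at most `2 ^ (m * m)`, so
    -- `x1` is still the identity.
    have hhalf : 2 ^ ((L.length + 1) * m) * ε < 1 / 2 := by
      refine lt_of_le_of_lt ?_ hεm
      gcongr
      · norm_num
      · rw [sq]; exact Nat.mul_le_mul_right m hL
    generalize hC : 2 ^ ((L.length + 1) * m) * ε = C at hB' hhalf ⊢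
    generalize 2 ^ (L.length * m) * ε = B at h2 hB hB'
    have hv0 := v.2.1
    have hBC : 2 * B ≤ C := by
      rw [hB']
      exact mul_le_mul_of_nonneg_right h2m (by linarith)
    rcases a with ⟨j, e⟩
    refine Fin.cases ?_ (fun j => Fin.cases ?_ (fun j => ?_) j) j
    · have hj : thompsonMarking m u 0 = x0 := rfl
      simp only [Fin.cons_zero, hj]
      cases e
      · simp only [cond, map_inv, FreeGroup.lift_apply_of, Fin.cons_zero, true_and]
        have h := coe_le_two_mul_x0 (x0⁻¹ v)
        rw [ThompsonF.apply_inv_self] at h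
        linarith
      · simp only [cond, FreeGroup.lift_apply_of, Fin.cons_zero, true_and]
        linarith [coe_x0_le v]
    · have hj : thompsonMarking m u (Fin.succ 0) = x0 ^ m * u 0 ^ m * x1 := rfl
      have hfix : ∀ x : unitInterval, ε ≤ x → (u 0 ^ m) x = x := by
        intro x hx
        generalize m = n
        induction n with
        | zero => rfl
        | succ n ih => rw [pow_succ', ThompsonF.mul_apply, ih, hu 0 x hx]
      have hone : (Fin.cons x0 u : Fin (k + 2) → ThompsonF) 1 = u 0 := rfl
      simp only [Fin.cons_zero, Fin.cons_succ, hj]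
      cases e
      · simp only [cond, map_inv, map_mul, map_pow, FreeGroup.lift_apply_of, Fin.cons_zero, hone]
        -- In the inverse letter `x1⁻¹` acts last, so the bound `C` after the expansion by `x0 ^
        -- (-m)` is needed, not just `B`.
        rw [mul_inv_rev _ x1, ThompsonF.mul_apply]
        have hlt : (((x0 ^ m * u 0 ^ m)⁻¹ : ThompsonF) v : ℝ) < C := by
          rw [mul_inv_rev, ThompsonF.mul_apply]
          refine apply_lt_of_fixes_ge (ε := ε) (fun x hx => inv_apply_eq_self (hfix x hx))
            (by linarith) (lt_of_le_of_lt (coe_x0_inv_pow_le m v) ?_)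
          rw [hB']
          gcongr
        have hx1 := inv_apply_eq_self (x1_apply_of_le (hlt.trans hhalf).le)
        rw [hx1]
        exact ⟨rfl, hlt⟩
      · simp only [cond, map_mul, map_pow, FreeGroup.lift_apply_of, Fin.cons_zero, hone]
        rw [ThompsonF.mul_apply _ x1, x1_apply_of_le (by linarith)]
        refine ⟨rfl, ?_⟩
        rw [ThompsonF.mul_apply]
        refine (coe_x0_pow_le m _).trans_lt ?_
        have := apply_lt_of_fixes_ge hfix hB h2
        linarith
    · have hj : thompsonMarking m u j.succ.succ = u j := rfl
      simp only [Fin.cons_succ, hj]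
      cases e
      · simp only [cond, map_inv, FreeGroup.lift_apply_of, Fin.cons_succ, true_and]
        have := apply_lt_of_fixes_ge (fun x hx => inv_apply_eq_self (hu j x hx)) hB h2
        linarith
      · simp only [cond, FreeGroup.lift_apply_of, Fin.cons_succ, true_and]
        have := apply_lt_of_fixes_ge (hu j) hB h2
        linarith

/-- The collapsed word has length at most `2 * m * m`, which is exactly the range covered by
admissibility, and the point it moves is moved by `w` as well. -/
theorem lift_thompsonMarking_ne_one {m : ℕ} {ε : ℝ} (hε : 0 < ε)
    (hεm : 2 ^ (m ^ 2) * ε < 1 / 2) {u : Fin (k + 1) → ThompsonF} (hu : IsAdmissible m ε u)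
    {w : FreeGroup (Fin (k + 3))} (hw : w ≠ 1) (hm : w.norm < m) :
    FreeGroup.lift (thompsonMarking m u) w ≠ 1 := by
  have hm1 : 1 ≤ m := by omega
  obtain ⟨x, hx, hne⟩ := hu.2 _ (collapse_ne_one hw hm) (by
    refine (norm_collapse_le hm1 w).trans ?_
    rw [sq, ← mul_assoc]
    exact Nat.mul_le_mul_left _ hm.le)
  intro h
  have h1 := (lift_thompsonMarking_apply hm1 hε hεm
    (fun i x hx => apply_eq_self_of_thompsonSupport (hu.1 i) hx) hx w.toWord hm.le).1
  rw [FreeGroup.mk_toWord, h] at h1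
  exact hne h1.symm

/-! ### Convergence and the residual property -/

theorem tendsto_mk_thompsonMarking {ε : ℕ → ℝ} {u : ℕ → Fin (k + 1) → ThompsonF}
    (h : ∀ m, 0 < ε m ∧ 2 ^ (m ^ 2) * ε m < 1 / 2 ∧ IsAdmissible m (ε m) (u m))
    (hgen : ∀ m, Subgroup.closure (Set.range (thompsonMarking m (u m))) = ⊤) :
    Tendsto (fun m => MarkedGroupSpace.mk
      { carrier := ThompsonF, gen := thompsonMarking m (u m), closure_gen := hgen m })
      atTop (𝓝 (MarkedGroupSpace.mk (MarkedGroup.free (k + 3)))) := by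
  rw [Metric.tendsto_atTop]
  intro δ hδ
  obtain ⟨R, hR⟩ := ((Real.tendsto_exp_neg_atTop_nhds_zero.comp
    tendsto_natCast_atTop_atTop).eventually (gt_mem_nhds hδ)).exists
  refine ⟨R + 1, fun m hm => lt_of_le_of_lt ?_ hR⟩
  refine (MarkedGroupSpace.dist_le_exp_iff R _ _).2 fun w hw => ?_
  by_cases hw1 : w = 1
  · subst hw1
    exact ⟨fun _ => one_mem _, fun _ => one_mem _⟩
  · constructor
    · intro hmem
      exact absurd hmem (lift_thompsonMarking_ne_one (h m).1 (h m).2.1 (h m).2.2 hw1 (by omega))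
    · intro hmem
      have h1 : FreeGroup.lift FreeGroup.of w = 1 := hmem
      rw [FreeGroup.lift_of_eq_id] at h1
      exact absurd h1 hw1

theorem fullyResidually_isThompson_freeGroup (k : ℕ) :
    FullyResidually IsThompson (FreeGroup (Fin (k + 3))) := by
  refine ⟨inferInstance, fun W hW => ?_⟩
  obtain ⟨m, hm⟩ : ∃ m, ∀ w ∈ W, w.norm < m :=
    ⟨W.sup FreeGroup.norm + 1, fun w hw => Nat.lt_succ_of_le (Finset.le_sup hw)⟩
  -- Any positive `ε` below `2 ^ (-m ^ 2) / 2` serves here.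
  have hε : (0 : ℝ) < 1 / 2 ^ (m ^ 2) / 4 := by positivity
  have hεm : (2 : ℝ) ^ (m ^ 2) * (1 / 2 ^ (m ^ 2) / 4) < 1 / 2 := by
    have : (2 : ℝ) ^ (m ^ 2) ≠ 0 := by positivity
    field_simp
    norm_num
  obtain ⟨u, hu⟩ := exists_isAdmissible k m hε
  refine ⟨ThompsonF, inferInstance, ⟨MulEquiv.refl _⟩,
    FreeGroup.lift (thompsonMarking m u), ?_, fun w hw =>
      lift_thompsonMarking_ne_one hε hεm hu (hW w hw) (hm w hw)⟩
  rw [← MonoidHom.range_eq_top, FreeGroup.range_lift_eq_closure, closure_range_thompsonMarking]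

end Marking

/-- The number of generators is `l = k + 3`, so that `l` ranges over all integers `≥ 3`. -/
theorem corollary3p6 (k : ℕ) :
    -- for every `m` the elements `u_{1,m}, …, u_{l-2,m}` exist
    (∀ (m : ℕ) (ε : ℝ), 0 < ε → 2 ^ (m ^ 2) * ε < 1 / 2 →
      ∃ u : Fin (k + 1) → ThompsonF, IsAdmissible m ε u) ∧
    -- for every choice of them, the tuples are markings of `F` and converge to the free group
    (∀ (ε : ℕ → ℝ) (u : ℕ → Fin (k + 1) → ThompsonF),
      (∀ m, 0 < ε m ∧ 2 ^ (m ^ 2) * ε m < 1 / 2 ∧ IsAdmissible m (ε m) (u m)) →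
      ∃ hgen : ∀ m, Subgroup.closure (Set.range (thompsonMarking m (u m))) = ⊤,
        Tendsto (fun m => MarkedGroupSpace.mk
            { carrier := ThompsonF, gen := thompsonMarking m (u m), closure_gen := hgen m })
          atTop (𝓝 (MarkedGroupSpace.mk (MarkedGroup.free (k + 3))))) ∧
    -- the free group of rank `l` is fully residually Thompson
    FullyResidually IsThompson (FreeGroup (Fin (k + 3))) := by
  exact ⟨fun m _ hε _ => exists_isAdmissible k m hε, fun _ _ h =>
    ⟨fun m => closure_range_thompsonMarking m _, tendsto_mk_thompsonMarking h _⟩,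
    fullyResidually_isThompson_freeGroup k⟩
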